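/- All functions and distributions are complex-valued (this contains the real-valued case) and $1$-periodic in each variable $x=(x_1,x_2)\in\mathbb R^2$; periodic distributions are the elements of the topological dual of $C^\infty(\mathbb R^2/\mathbb Z^2)$, periodic functions integrable on $[0,1)^2$ are identified with distributions, and $\hat f(k)$ denotes the Fourier coefficient of $f$ at $k\in(2\pi\mathbb Z)^2$. The operators $|\partial_1|^{-1}$ and $R$ (Hilbert transform in $x_1$) multiply $\hat f(k)$ by $|k_1|^{-1}$ and $i\,\mathrm{sgn}(k_1)$, respectively, if $k_1\neq 0$, and by $0$ if $k_1=0$; put $\mathcal L=-\partial_1^2-|\partial_1|^{-1}\partial_2^2$. Let $d(x,y)=|x_1-y_1|+|x_2-y_2|^{2/3}$. For a periodic function $u$ let $$[u]_\alpha=\sup_{x\ne y}\frac{|u(y)-u(x)|}{d(x,y)^{\alpha}}\ \ (0<\alpha\le 1),\qquad [u]_\alpha=\sup_{x\ne y}\frac{|u(y)-u(x)-\partial_1u(x)(y_1-x_1)|}{d(x,y)^{\alpha}}\ \ (1<\alpha<\tfrac32),$$ the suprema being over $x,y\in\mathbb R^2$. For a periodic distribution $f$ let $[f]_\alpha=[u]_\alpha$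 if $f$ is represented by a function $u$ with $[u]_\alpha<\infty$ (which is then continuous and unique), and $[f]_\alpha=\infty$ otherwise. For $-\frac32<\beta<0$ and a periodic distribution $f$ let $$[f]_\beta=\inf\{|c|+[g]_{\beta+1}+[h]_{\beta+3/2}: f=c+\partial_1g+\partial_2h\}\ \ (\beta>-1),$$ $$[f]_\beta=\inf\{|c|+[g]_{\beta+2}+[h]_{\beta+3/2}: f=c+\partial_1^2g+\partial_2h\}\ \ (\beta\le-1),$$ where $c$ ranges over constants and $g,h$ over periodic functions, with $\inf\emptyset=\infty$. Claim: for every $\alpha\in(\frac12,\frac32)\setminus\{1\}$ there is a constant $C<\infty$, depending only on $\alpha$, such that every periodic distribution $f$ (in particular every periodic function $f$ integrable on $[0,1)^2$) of vanishing average in $x_1$, that is, with $\hat f(0,k_2)=0$ for all $k_2\in 2\pi\mathbb Z$, satisfies $$[f]_\alpha+[Rf]_\alpha\le C\,[\mathcal Lf]_{\alpha-2}.$$ In particular, if $[\mathcal Lf]_{\alpha-2}<\infty$, then $f$ and $Rf$ are functions of class $C^\alpha$. -/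

import Mathlib

open MeasureTheory
open scoped ENNReal NNReal ContDiff

noncomputable section

namespace AnisoTorus

/-- Functions on the plane that are `1`-periodic in both variables. -/
def IsPeriodic (u : ℝ × ℝ → ℂ) : Prop :=
  ∀ x : ℝ × ℝ, u (x.1 + 1, x.2) = u x ∧ u (x.1, x.2 + 1) = u x

/-- The fundamental cell `[0,1)²`. -/
def cell : Set (ℝ × ℝ) := Set.Ico (0 : ℝ) 1 ×ˢ Set.Ico (0 : ℝ) 1

/-! ### Smooth periodic functions and their topology -/

/-- The smooth periodic functions, as a subspace of all functions. -/
def testSubmodule : Submodule ℂ (ℝ × ℝ → ℂ) where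
  carrier := {φ | ContDiff ℝ ∞ φ ∧ IsPeriodic φ}
  add_mem' := by
    rintro a b ⟨ha, ha'⟩ ⟨hb, hb'⟩
    refine ⟨ha.add hb, fun x => ⟨?_, ?_⟩⟩
    · simp [(ha' x).1, (hb' x).1]
    · simp [(ha' x).2, (hb' x).2]
  zero_mem' := ⟨contDiff_const, fun _ => ⟨rfl, rfl⟩⟩
  smul_mem' := by
    rintro c a ⟨ha, ha'⟩
    refine ⟨contDiff_const.smul ha, fun x => ⟨?_, ?_⟩⟩
    · simp [(ha' x).1]
    · simp [(ha' x).2]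

/-- The space `C^∞` of smooth functions on the two-dimensional torus. -/
def TestFun : Type := testSubmodule

namespace TestFun

instance : AddCommGroup TestFun := inferInstanceAs (AddCommGroup testSubmodule)
instance : Module ℂ TestFun := inferInstanceAs (Module ℂ testSubmodule)
instance : FunLike TestFun (ℝ × ℝ) ℂ := ⟨fun φ => φ.1, Subtype.val_injective⟩

theorem contDiff (φ : TestFun) : ContDiff ℝ ∞ φ := φ.2.1
theorem periodic (φ : TestFun) : IsPeriodic φ := φ.2.2
theorem continuous (φ : TestFun) : Continuous φ := φ.contDiff.continuous
theorem differentiable (φ : TestFun) : Differentiable ℝ φ :=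
  φ.contDiff.differentiable (by simp)

@[ext] theorem ext {φ ψ : TestFun} (h : ∀ x, φ x = ψ x) : φ = ψ := DFunLike.ext _ _ h

@[simp] theorem add_apply (φ ψ : TestFun) (x : ℝ × ℝ) : (φ + ψ) x = φ x + ψ x := rfl
@[simp] theorem smul_apply (c : ℂ) (φ : TestFun) (x : ℝ × ℝ) : (c • φ) x = c * φ x := rfl

theorem coe_add (φ ψ : TestFun) : ⇑(φ + ψ) = ⇑φ + ⇑ψ := rfl
theorem coe_smul (c : ℂ) (φ : TestFun) : ⇑(c • φ) = c • ⇑φ := rfl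

theorem exists_bound (φ : TestFun) : ∃ C, ∀ x, ‖φ x‖ ≤ C := by
  have hK : IsCompact (Set.Icc (0 : ℝ) 1 ×ˢ Set.Icc (0 : ℝ) 1) :=
    isCompact_Icc.prod isCompact_Icc
  obtain ⟨C, hC⟩ := hK.exists_bound_of_continuousOn φ.continuous.continuousOn
  refine ⟨C, fun x => ?_⟩
  have h1 : ∀ b, Function.Periodic (fun a => φ (a, b)) 1 := fun b a => (φ.periodic (a, b)).1
  have h2 : ∀ a, Function.Periodic (fun b => φ (a, b)) 1 := fun a b => (φ.periodic (a, b)).2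
  have e1 : φ x = φ (Int.fract x.1, Int.fract x.2) := by
    have a1 := (h1 x.2).sub_int_mul_eq (x := x.1) ⌊x.1⌋
    have a2 := (h2 (Int.fract x.1)).sub_int_mul_eq (x := x.2) ⌊x.2⌋
    simp only [mul_one, Int.self_sub_floor] at a1 a2
    rw [a2, a1]
  rw [e1]
  exact hC _ ⟨⟨Int.fract_nonneg _, (Int.fract_lt_one _).le⟩,
    ⟨Int.fract_nonneg _, (Int.fract_lt_one _).le⟩⟩

theorem bddAbove (φ : TestFun) : BddAbove (Set.range fun x => ‖φ x‖) := by
  obtain ⟨C, hC⟩ := φ.exists_bound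
  exact ⟨C, by rintro _ ⟨x, rfl⟩; exact hC x⟩

/-- The directional derivative of a smooth periodic function. -/
def dirDeriv (v : ℝ × ℝ) : TestFun →ₗ[ℂ] TestFun where
  toFun φ := ⟨fun x => fderiv ℝ φ x v, by
    refine ⟨(φ.contDiff.fderiv_right (m := ∞) (by simp)).clm_apply contDiff_const, fun x => ?_⟩
    have key : ∀ w : ℝ × ℝ, (∀ y, φ (y + w) = φ y) →
        fderiv ℝ φ (x + w) v = fderiv ℝ φ x v := by
      intro w hw
      rw [← fderiv_comp_add_right w]
      congr 2
      exact funext hw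
    constructor
    · have := key (1, 0) fun y => by
        have := (φ.periodic y).1
        rwa [show y + (1, 0) = (y.1 + 1, y.2) by ext <;> simp]
      rwa [show x + (1, 0) = (x.1 + 1, x.2) by ext <;> simp] at this
    · have := key (0, 1) fun y => by
        have := (φ.periodic y).2
        rwa [show y + (0, 1) = (y.1, y.2 + 1) by ext <;> simp]
      rwa [show x + (0, 1) = (x.1, x.2 + 1) by ext <;> simp] at this⟩
  map_add' φ ψ := by
    ext x
    change fderiv ℝ (⇑φ + ⇑ψ) x v = fderiv ℝ φ x v + fderiv ℝ ψ x v
    rw [fderiv_add (φ.differentiable x) (ψ.differentiable x)]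
    rfl
  map_smul' c φ := by
    ext x
    change fderiv ℝ (c • ⇑φ) x v = c * fderiv ℝ φ x v
    rw [fderiv_const_smul (φ.differentiable x)]
    rfl

theorem dirDeriv_apply (v : ℝ × ℝ) (φ : TestFun) (x : ℝ × ℝ) :
    dirDeriv v φ x = fderiv ℝ φ x v := rfl

theorem dirDeriv_comm (v w : ℝ × ℝ) : Commute (dirDeriv v) (dirDeriv w) := by
  refine LinearMap.ext fun φ => TestFun.ext fun x => ?_
  have hd : DifferentiableAt ℝ (fderiv ℝ φ) x :=
    ((φ.contDiff.fderiv_right (m := ∞) (by simp)).differentiable (by simp)) x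
  have key : ∀ a b : ℝ × ℝ, dirDeriv a (dirDeriv b φ) x = fderiv ℝ (fderiv ℝ φ) x a b := by
    intro a b
    change fderiv ℝ (fun y => fderiv ℝ φ y b) x a = _
    rw [fderiv_clm_apply hd (differentiableAt_const b)]
    simp
  change dirDeriv v (dirDeriv w φ) x = dirDeriv w (dirDeriv v φ) x
  rw [key, key]
  exact (φ.contDiff.contDiffAt.isSymmSndFDerivAt (n := ∞)
    (by simp only [minSmoothness_of_isRCLikeNormedField]; exact WithTop.coe_le_coe.2 le_top)).eq v w

/-- The partial derivative `∂₁` of smooth periodic functions. -/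
def d1 : TestFun →ₗ[ℂ] TestFun := dirDeriv (1, 0)
/-- The partial derivative `∂₂` of smooth periodic functions. -/
def d2 : TestFun →ₗ[ℂ] TestFun := dirDeriv (0, 1)

/-- The supremum norm `‖φ‖`. -/
def supNorm : Seminorm ℂ TestFun :=
  Seminorm.of (fun φ => ⨆ x, ‖φ x‖)
    (fun φ ψ => ciSup_le fun x => (norm_add_le (φ x) (ψ x)).trans
      (add_le_add (le_ciSup φ.bddAbove x) (le_ciSup ψ.bddAbove x)))
    (fun c φ => by
      change (⨆ x, ‖c * φ x‖) = _
      simp_rw [norm_mul]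
      exact (Real.mul_iSup_of_nonneg (norm_nonneg c) _).symm)

theorem norm_apply_le (φ : TestFun) (x : ℝ × ℝ) : ‖φ x‖ ≤ supNorm φ := le_ciSup φ.bddAbove x

theorem supNorm_le {φ : TestFun} {C : ℝ} (h : ∀ x, ‖φ x‖ ≤ C) : supNorm φ ≤ C := ciSup_le h

/-- The seminorms `‖∂₁ʲ ∂₂ˡ φ‖`. -/
def seminorms : SeminormFamily ℂ TestFun (ℕ × ℕ) :=
  fun jl => supNorm.comp (d1 ^ jl.1 * d2 ^ jl.2)

theorem seminorms_apply (j l : ℕ) (φ : TestFun) :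
    seminorms (j, l) φ = supNorm ((d1 ^ j) ((d2 ^ l) φ)) := rfl

/-- The topology of smooth functions on the torus, given by these seminorms. -/
instance : TopologicalSpace TestFun := seminorms.moduleFilterBasis.topology

theorem withSeminorms : WithSeminorms seminorms := ⟨rfl⟩

theorem continuous_d1 : Continuous d1 := by
  refine withSeminorms.continuous_of_isBounded withSeminorms _ fun jl => ?_
  refine ⟨{(jl.1 + 1, jl.2)}, 1, fun φ => le_of_eq ?_⟩
  simp only [Finset.sup_singleton, one_smul, Seminorm.comp_apply]
  have d2_d1_comm : Commute (d2 ^ jl.2) d1 := (dirDeriv_comm (0, 1) (1, 0)).pow_left jl.2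
  change supNorm ((d1 ^ jl.1 * d2 ^ jl.2 * d1) φ) = supNorm ((d1 ^ (jl.1 + 1) * d2 ^ jl.2) φ)
  rw [pow_succ, mul_assoc, mul_assoc, d2_d1_comm.eq]

theorem continuous_d2 : Continuous d2 := by
  refine withSeminorms.continuous_of_isBounded withSeminorms _ fun jl => ?_
  refine ⟨{(jl.1, jl.2 + 1)}, 1, fun φ => le_of_eq ?_⟩
  simp only [Finset.sup_singleton, one_smul, Seminorm.comp_apply]
  change supNorm ((d1 ^ jl.1 * d2 ^ jl.2 * d2) φ) = supNorm ((d1 ^ jl.1 * d2 ^ (jl.2 + 1)) φ)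
  rw [pow_succ, mul_assoc]

/-- A linear functional is continuous once it is bounded by one of finitely many seminorms. -/
theorem continuous_functional (T : TestFun →ₗ[ℂ] ℂ) (s : Finset (ℕ × ℕ)) (C : ℝ≥0)
    (h : ∀ φ, ‖T φ‖ ≤ C * (s.sup seminorms) φ) : Continuous T :=
  WithSeminorms.continuous_normedSpace_rng ℂ withSeminorms T ⟨s, C, fun φ => h φ⟩

/-- The exponential `x ↦ exp(2πi k·x)`. -/
def expo (k : ℤ × ℤ) : TestFun :=
  ⟨fun x => Complex.exp (2 * Real.pi * Complex.I * (k.1 * x.1 + k.2 * x.2)), by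
    constructor
    · have h1 : ContDiff ℝ ∞ fun x : ℝ × ℝ => (x.1 : ℂ) :=
        Complex.ofRealCLM.contDiff.comp contDiff_fst
      have h2 : ContDiff ℝ ∞ fun x : ℝ × ℝ => (x.2 : ℂ) :=
        Complex.ofRealCLM.contDiff.comp contDiff_snd
      exact (contDiff_const.mul ((contDiff_const.mul h1).add (contDiff_const.mul h2))).cexp
    · intro x
      constructor
      · rw [Complex.exp_eq_exp_iff_exists_int]
        exact ⟨k.1, by push_cast; ring⟩
      · rw [Complex.exp_eq_exp_iff_exists_int]
        exact ⟨k.2, by push_cast; ring⟩⟩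

theorem expo_apply (k : ℤ × ℤ) (x : ℝ × ℝ) :
    expo k x = Complex.exp (2 * Real.pi * Complex.I * (k.1 * x.1 + k.2 * x.2)) := rfl


theorem dirDeriv_expo (v : ℝ × ℝ) (k : ℤ × ℤ) :
    dirDeriv v (expo k) = (2 * Real.pi * Complex.I * (k.1 * v.1 + k.2 * v.2) : ℂ) • expo k := by
  ext x
  rw [smul_apply, dirDeriv_apply, expo_apply]
  have h1 : HasFDerivAt (fun x : ℝ × ℝ => (x.1 : ℂ))
      (Complex.ofRealCLM.comp (ContinuousLinearMap.fst ℝ ℝ ℝ)) x :=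
    (Complex.ofRealCLM.comp (ContinuousLinearMap.fst ℝ ℝ ℝ)).hasFDerivAt
  have h2 : HasFDerivAt (fun x : ℝ × ℝ => (x.2 : ℂ))
      (Complex.ofRealCLM.comp (ContinuousLinearMap.snd ℝ ℝ ℝ)) x :=
    (Complex.ofRealCLM.comp (ContinuousLinearMap.snd ℝ ℝ ℝ)).hasFDerivAt
  have h := ((((h1.const_mul (k.1 : ℂ)).add (h2.const_mul (k.2 : ℂ))).const_mul
    (2 * Real.pi * Complex.I : ℂ))).cexp
  have h' : fderiv ℝ (expo k) x = _ := h.fderiv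
  rw [h']
  simp
  ring

theorem d1_expo (k : ℤ × ℤ) : d1 (expo k) = (2 * Real.pi * Complex.I * k.1 : ℂ) • expo k := by
  rw [d1, dirDeriv_expo]; simp

theorem d2_expo (k : ℤ × ℤ) : d2 (expo k) = (2 * Real.pi * Complex.I * k.2 : ℂ) • expo k := by
  rw [d2, dirDeriv_expo]; simp

theorem norm_expo (k : ℤ × ℤ) (x : ℝ × ℝ) : ‖expo k x‖ = 1 := by
  rw [expo_apply, show (2 * Real.pi * Complex.I * (k.1 * x.1 + k.2 * x.2) : ℂ)
    = ((2 * Real.pi * (k.1 * x.1 + k.2 * x.2) : ℝ) : ℂ) * Complex.I by push_cast; ring]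
  exact Complex.norm_exp_ofReal_mul_I _

theorem expo_mul (k l : ℤ × ℤ) (x : ℝ × ℝ) : expo k x * expo l x = expo (k + l) x := by
  simp only [expo_apply, ← Complex.exp_add, Prod.fst_add, Prod.snd_add]
  congr 1; push_cast; ring

theorem d_pow_expo (j l : ℕ) (k : ℤ × ℤ) : (d1 ^ j) ((d2 ^ l) (expo k)) =
    ((2 * Real.pi * Complex.I * k.1) ^ j * (2 * Real.pi * Complex.I * k.2) ^ l : ℂ) • expo k := by
  have h2 : (d2 ^ l) (expo k) = ((2 * Real.pi * Complex.I * k.2) ^ l : ℂ) • expo k := by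
    induction l with
    | zero => simp
    | succ l ih => rw [pow_succ', Module.End.mul_apply, ih, map_smul, d2_expo, smul_smul, pow_succ]
  have h1 : (d1 ^ j) (expo k) = ((2 * Real.pi * Complex.I * k.1) ^ j : ℂ) • expo k := by
    induction j with
    | zero => simp
    | succ j ih => rw [pow_succ', Module.End.mul_apply, ih, map_smul, d1_expo, smul_smul, pow_succ]
  rw [h2, map_smul, h1, smul_smul, mul_comm]

theorem seminorms_expo_le (j l : ℕ) (k : ℤ × ℤ) :
    seminorms (j, l) (expo k) ≤ (2 * Real.pi * |(k.1 : ℝ)|) ^ j * (2 * Real.pi * |(k.2 : ℝ)|) ^ l := by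
  rw [seminorms_apply, d_pow_expo]
  refine supNorm_le fun x => le_of_eq ?_
  rw [smul_apply, norm_mul, norm_expo]
  simp [abs_of_pos Real.pi_pos]

/-! ### Integration over the cell -/

theorem integrableOn_mul {u : ℝ × ℝ → ℂ} (hu : IntegrableOn u cell) (φ : TestFun) :
    IntegrableOn (fun x => u x * φ x) cell :=
  Integrable.mul_bdd hu φ.continuous.aestronglyMeasurable
    (Filter.Eventually.of_forall φ.norm_apply_le)

theorem volume_cell : volume cell = 1 := by
  rw [cell, Measure.volume_eq_prod, Measure.prod_prod]; simp

theorem integrableOn (φ : TestFun) : IntegrableOn φ cell :=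
  Measure.integrableOn_of_bounded (M := supNorm φ) (by simp [volume_cell])
    φ.continuous.aestronglyMeasurable (Filter.Eventually.of_forall φ.norm_apply_le)

theorem norm_integral_le (φ : TestFun) : ‖∫ x in cell, φ x‖ ≤ supNorm φ := by
  have := norm_setIntegral_le_of_norm_le_const (μ := volume) (s := cell) (f := φ)
    (C := supNorm φ) (by simp [volume_cell]) (fun x _ => φ.norm_apply_le x)
  simpa [Measure.real, volume_cell] using this

theorem integral_d2 (φ : TestFun) : ∫ x in cell, d2 φ x = 0 := by
  have hint := (d2 φ).integrableOn
  rw [cell, Measure.volume_eq_prod] at *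
  rw [setIntegral_prod _ hint]
  refine integral_eq_zero_of_ae (Filter.Eventually.of_forall fun a => ?_)
  change ∫ y in Set.Ico (0 : ℝ) 1, d2 φ (a, y) = 0
  rw [integral_Ico_eq_integral_Ioc, ← intervalIntegral.integral_of_le zero_le_one,
    intervalIntegral.integral_eq_sub_of_hasDerivAt (f := fun y => φ (a, y))]
  · have := (φ.periodic (a, 0)).2
    simp only [zero_add] at this
    simp [this]
  · intro y _
    have h1 := (φ.differentiable (a, y)).hasFDerivAt
    have h2 : HasDerivAt (fun y : ℝ => (a, y)) ((0 : ℝ), (1 : ℝ)) y :=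
      (hasDerivAt_const y a).prodMk (hasDerivAt_id y)
    exact h1.comp_hasDerivAt y h2
  · exact ((d2 φ).continuous.comp (by fun_prop)).intervalIntegrable _ _

theorem integral_d1 (φ : TestFun) : ∫ x in cell, d1 φ x = 0 := by
  have hint := (d1 φ).integrableOn
  rw [cell, Measure.volume_eq_prod] at *
  rw [← setIntegral_prod_swap]
  change ∫ z in Set.Ico (0 : ℝ) 1 ×ˢ Set.Ico (0 : ℝ) 1, (d1 φ ∘ Prod.swap) z ∂_ = 0
  rw [setIntegral_prod _ hint.swap]
  refine integral_eq_zero_of_ae (Filter.Eventually.of_forall fun a => ?_)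
  change ∫ y in Set.Ico (0 : ℝ) 1, d1 φ (y, a) = 0
  rw [integral_Ico_eq_integral_Ioc, ← intervalIntegral.integral_of_le zero_le_one,
    intervalIntegral.integral_eq_sub_of_hasDerivAt (f := fun y => φ (y, a))]
  · have := (φ.periodic (0, a)).1
    simp only [zero_add] at this
    simp [this]
  · intro y _
    have h1 := (φ.differentiable (y, a)).hasFDerivAt
    have h2 : HasDerivAt (fun y : ℝ => (y, a)) ((1 : ℝ), (0 : ℝ)) y :=
      (hasDerivAt_id y).prodMk (hasDerivAt_const y a)
    exact h1.comp_hasDerivAt y h2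
  · exact ((d1 φ).continuous.comp (by fun_prop)).intervalIntegrable _ _

/-- The pointwise product of two smooth periodic functions. -/
def mul (φ ψ : TestFun) : TestFun :=
  ⟨fun x => φ x * ψ x, φ.contDiff.mul ψ.contDiff, fun x => by
    simp [(φ.periodic x).1, (φ.periodic x).2, (ψ.periodic x).1, (ψ.periodic x).2]⟩

theorem mul_apply (φ ψ : TestFun) (x : ℝ × ℝ) : mul φ ψ x = φ x * ψ x := rfl

theorem dirDeriv_mul (v : ℝ × ℝ) (φ ψ : TestFun) (x : ℝ × ℝ) :
    dirDeriv v (mul φ ψ) x = φ x * dirDeriv v ψ x + dirDeriv v φ x * ψ x := by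
  change fderiv ℝ (fun x => φ x * ψ x) x v = _
  rw [fderiv_fun_mul (φ.differentiable x) (ψ.differentiable x)]
  simp [dirDeriv_apply, mul_comm]

/-- The Fourier coefficient `∫_{[0,1)²} exp(-2πi k·x) φ(x) dx` of a smooth periodic function. -/
def fourier (k : ℤ × ℤ) : TestFun →ₗ[ℂ] ℂ where
  toFun φ := ∫ x in cell, expo (-k) x * φ x
  map_add' φ ψ := by
    simp_rw [add_apply, mul_add]
    exact integral_add (integrableOn_mul (expo (-k)).integrableOn φ)
      (integrableOn_mul (expo (-k)).integrableOn ψ)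
  map_smul' c φ := by
    simp_rw [smul_apply, mul_left_comm _ c]
    exact integral_const_mul c _

theorem fourier_apply (k : ℤ × ℤ) (φ : TestFun) :
    fourier k φ = ∫ x in cell, expo (-k) x * φ x := rfl

theorem norm_fourier_le (k : ℤ × ℤ) (φ : TestFun) : ‖fourier k φ‖ ≤ supNorm φ :=
  (norm_integral_le (mul (expo (-k)) φ)).trans
    (supNorm_le fun x => by rw [mul_apply, norm_mul, norm_expo, one_mul]; exact φ.norm_apply_le x)

theorem fourier_d1 (k : ℤ × ℤ) (φ : TestFun) :
    fourier k (d1 φ) = 2 * Real.pi * Complex.I * k.1 * fourier k φ := by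
  have h := integral_d1 (mul (expo (-k)) φ)
  have e : ∀ x, d1 (mul (expo (-k)) φ) x = expo (-k) x * d1 φ x
      + (2 * Real.pi * Complex.I * ((-k).1 : ℤ)) * (expo (-k) x * φ x) := fun x => by
    have := dirDeriv_mul (1, 0) (expo (-k)) φ x
    change d1 (mul (expo (-k)) φ) x = expo (-k) x * d1 φ x + d1 (expo (-k)) x * φ x at this
    rw [this, d1_expo, smul_apply]; ring
  simp_rw [e] at h
  rw [integral_add (integrableOn_mul (expo (-k)).integrableOn (d1 φ))
    ((integrableOn_mul (expo (-k)).integrableOn φ).const_mul _), integral_const_mul] at h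
  rw [fourier_apply, fourier_apply, eq_neg_of_add_eq_zero_left h]
  push_cast [Prod.fst_neg]; ring

theorem fourier_d2 (k : ℤ × ℤ) (φ : TestFun) :
    fourier k (d2 φ) = 2 * Real.pi * Complex.I * k.2 * fourier k φ := by
  have h := integral_d2 (mul (expo (-k)) φ)
  have e : ∀ x, d2 (mul (expo (-k)) φ) x = expo (-k) x * d2 φ x
      + (2 * Real.pi * Complex.I * ((-k).2 : ℤ)) * (expo (-k) x * φ x) := fun x => by
    have := dirDeriv_mul (0, 1) (expo (-k)) φ x
    change d2 (mul (expo (-k)) φ) x = expo (-k) x * d2 φ x + d2 (expo (-k)) x * φ x at this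
    rw [this, d2_expo, smul_apply]; ring
  simp_rw [e] at h
  rw [integral_add (integrableOn_mul (expo (-k)).integrableOn (d2 φ))
    ((integrableOn_mul (expo (-k)).integrableOn φ).const_mul _), integral_const_mul] at h
  rw [fourier_apply, fourier_apply, eq_neg_of_add_eq_zero_left h]
  push_cast [Prod.snd_neg]; ring

theorem fourier_expo (k l : ℤ × ℤ) : fourier k (expo l) = if k = l then 1 else 0 := by
  split_ifs with h
  · subst h
    simp_rw [fourier_apply, expo_mul]
    simp [expo_apply, Measure.real, volume_cell]
  · have h1 := fourier_d1 k (expo l)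
    have h2 := fourier_d2 k (expo l)
    rw [d1_expo, map_smul, smul_eq_mul] at h1
    rw [d2_expo, map_smul, smul_eq_mul] at h2
    have hp := Complex.two_pi_I_ne_zero
    by_contra hne
    have e1 := mul_left_cancel₀ hp (mul_right_cancel₀ hne h1)
    have e2 := mul_left_cancel₀ hp (mul_right_cancel₀ hne h2)
    exact h (Prod.ext (by exact_mod_cast e1.symm) (by exact_mod_cast e2.symm))

theorem norm_fourier_mul_le (j l : ℕ) (k : ℤ × ℤ) (φ : TestFun) :
    |(k.1 : ℝ)| ^ j * |(k.2 : ℝ)| ^ l * ‖fourier k φ‖ ≤ seminorms (j, l) φ := by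
  have h2 : ∀ φ, fourier k ((d2 ^ l) φ) = (2 * Real.pi * Complex.I * k.2) ^ l * fourier k φ := by
    induction l with
    | zero => simp
    | succ l ih => intro φ; rw [pow_succ, Module.End.mul_apply, ih, fourier_d2]; ring
  have h1 : ∀ φ, fourier k ((d1 ^ j) φ) = (2 * Real.pi * Complex.I * k.1) ^ j * fourier k φ := by
    induction j with
    | zero => simp
    | succ j ih => intro φ; rw [pow_succ, Module.End.mul_apply, ih, fourier_d1]; ring
  have h := norm_fourier_le k ((d1 ^ j) ((d2 ^ l) φ))
  rw [h1, h2, ← seminorms_apply] at h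
  refine le_trans ?_ h
  have hpi : (1 : ℝ) ≤ 2 * Real.pi := by linarith [Real.pi_gt_three]
  have b : ∀ n : ℤ, |(n : ℝ)| ≤ 2 * Real.pi * |(n : ℝ)| := fun n =>
    le_mul_of_one_le_left (abs_nonneg _) hpi
  rw [norm_mul, norm_mul, ← mul_assoc]
  gcongr
  · simpa [abs_of_pos Real.pi_pos] using pow_le_pow_left₀ (abs_nonneg _) (b k.1) j
  · simpa [abs_of_pos Real.pi_pos] using pow_le_pow_left₀ (abs_nonneg _) (b k.2) l

end TestFun

/-! ### Periodic distributions -/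

/-- Periodic distributions: the topological dual of the smooth functions on the torus. -/
abbrev PerDistr : Type := TestFun →L[ℂ] ℂ

/-- Periodic functions that are integrable over the cell. -/
structure PerFun where
  toFun : ℝ × ℝ → ℂ
  periodic : IsPeriodic toFun
  integrable : IntegrableOn toFun cell

namespace PerFun

instance : CoeFun PerFun (fun _ => ℝ × ℝ → ℂ) := ⟨toFun⟩

/-- The constant functions. -/
def const (c : ℂ) : PerFun where
  toFun _ := c
  periodic _ := ⟨rfl, rfl⟩
  integrable := integrableOn_const (by simp [TestFun.volume_cell])

/-- The pairing `φ ↦ ∫_{[0,1)²} u φ dx`. -/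
def pairing (u : PerFun) : TestFun →ₗ[ℂ] ℂ where
  toFun φ := ∫ x in cell, u x * φ x
  map_add' φ ψ := by
    simp_rw [TestFun.add_apply, mul_add]
    exact integral_add (TestFun.integrableOn_mul u.integrable φ)
      (TestFun.integrableOn_mul u.integrable ψ)
  map_smul' c φ := by
    simp_rw [TestFun.smul_apply, mul_left_comm _ c]
    exact integral_const_mul c _

theorem continuous_pairing (u : PerFun) : Continuous u.pairing := by
  refine TestFun.continuous_functional u.pairing
    {(0, 0)} (∫ x in cell, ‖u x‖).toNNReal fun φ => ?_
  rw [Finset.sup_singleton, Real.coe_toNNReal _ (integral_nonneg fun _ => norm_nonneg _),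
    ← integral_mul_const]
  refine norm_integral_le_of_norm_le (u.integrable.norm.mul_const _)
    (Filter.Eventually.of_forall fun x => ?_)
  rw [norm_mul]
  exact mul_le_mul_of_nonneg_left (φ.norm_apply_le x) (norm_nonneg _)

/-- The distribution `φ ↦ ∫_{[0,1)²} u φ dx` of a periodic function `u`. -/
def toDistr (u : PerFun) : PerDistr := ⟨u.pairing, u.continuous_pairing⟩

end PerFun

namespace PerDistr

/-- The partial derivative `∂₁` of a periodic distribution, by duality. -/
def d1 (f : PerDistr) : PerDistr := -(f.comp ⟨TestFun.d1, TestFun.continuous_d1⟩)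
/-- The partial derivative `∂₂` of a periodic distribution, by duality. -/
def d2 (f : PerDistr) : PerDistr := -(f.comp ⟨TestFun.d2, TestFun.continuous_d2⟩)

/-- The Fourier coefficient at the frequency `2πk`, that is, `f` tested with `exp(-2πi k·x)`. -/
def coeff (f : PerDistr) (k : ℤ × ℤ) : ℂ := f (TestFun.expo (-k))

/-- A summable weight on the frequencies. -/
def weight (k : ℤ × ℤ) : ℝ := (1 / (1 + |(k.1 : ℝ)|) ^ 2) * (1 / (1 + |(k.2 : ℝ)|) ^ 2)

theorem summable_weight : Summable weight := by
  have h : Summable fun n : ℤ => 1 / (1 + |(n : ℝ)|) ^ 2 := by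
    have h0 : Summable fun n : ℤ => 4 * |(n : ℝ)| ^ (-2 : ℝ) + (if n = 0 then 1 else 0 : ℝ) :=
      ((Real.summable_abs_int_rpow (b := 2) (by norm_num)).mul_left 4).add
        (summable_of_hasFiniteSupport ((Set.finite_singleton (0 : ℤ)).subset fun n hn => by
          by_contra h; simp_all))
    refine Summable.of_nonneg_of_le (fun n => by positivity) (fun n => ?_) h0
    by_cases hn : n = 0
    · simp [hn]
    · have hpos : 0 < |(n : ℝ)| := by simpa using hn
      rw [if_neg hn, Real.rpow_neg hpos.le, add_zero, one_div]
      norm_cast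
      push_cast
      rw [← div_eq_mul_inv, inv_eq_one_div, div_le_div_iff₀ (by positivity) (by positivity)]
      nlinarith
  exact h.mul_of_nonneg h (fun _ => by positivity) (fun _ => by positivity)

theorem growth (f : PerDistr) : ∃ (K : ℝ) (N : ℕ), 0 ≤ K ∧
    ∀ k, ‖f.coeff k‖ ≤ K * ((1 + |(k.1 : ℝ)|) ^ N * (1 + |(k.2 : ℝ)|) ^ N) := by
  obtain ⟨s, C, -, h⟩ := Seminorm.bound_of_continuous TestFun.withSeminorms
    ((normSeminorm ℂ ℂ).comp f.toLinearMap) (continuous_norm.comp f.continuous)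
  set N : ℕ := s.sup fun jl => jl.1 + jl.2 with hN
  refine ⟨C * ((2 * Real.pi) ^ N * (2 * Real.pi) ^ N), N, by positivity, fun k => ?_⟩
  have h1 : ‖f.coeff k‖ ≤ C * (s.sup TestFun.seminorms) (TestFun.expo (-k)) := h (TestFun.expo (-k))
  refine h1.trans ?_
  rw [mul_assoc]
  refine mul_le_mul_of_nonneg_left ?_ C.2
  refine Seminorm.finset_sup_apply_le (by positivity) fun jl hjl => ?_
  refine (TestFun.seminorms_expo_le jl.1 jl.2 (-k)).trans ?_
  have hle : jl.1 + jl.2 ≤ N := Finset.le_sup (f := fun jl : ℕ × ℕ => jl.1 + jl.2) hjl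
  have hpi : (1 : ℝ) ≤ 2 * Real.pi := by linarith [Real.pi_gt_three]
  have b : ∀ (n : ℤ) (j : ℕ), j ≤ N →
      (2 * Real.pi * |(n : ℝ)|) ^ j ≤ (2 * Real.pi) ^ N * (1 + |(n : ℝ)|) ^ N := by
    intro n j hj
    rw [mul_pow]
    have h2 : |(n : ℝ)| ^ j ≤ (1 + |(n : ℝ)|) ^ j :=
      pow_le_pow_left₀ (abs_nonneg _) (by linarith [abs_nonneg (n : ℝ)]) j
    have h3 : (1 + |(n : ℝ)|) ^ j ≤ (1 + |(n : ℝ)|) ^ N :=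
      pow_le_pow_right₀ (by linarith [abs_nonneg (n : ℝ)]) hj
    exact mul_le_mul (pow_le_pow_right₀ hpi hj) (h2.trans h3) (by positivity) (by positivity)
  have b1 := b (-k).1 jl.1 (by omega)
  have b2 := b (-k).2 jl.2 (by omega)
  simp only [Prod.fst_neg, Prod.snd_neg, Int.cast_neg, abs_neg] at b1 b2 ⊢
  calc _ ≤ _ := mul_le_mul b1 b2 (by positivity) (by positivity)
    _ = _ := by ring

theorem decay (M : ℕ) (φ : TestFun) (k : ℤ × ℤ) :
    (1 + |(k.1 : ℝ)|) ^ M * (1 + |(k.2 : ℝ)|) ^ M * ‖TestFun.fourier k φ‖ ≤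
      4 ^ M * 4 * (({(0, 0), (M, 0), (0, M), (M, M)} : Finset (ℕ × ℕ)).sup TestFun.seminorms) φ := by
  set s : Finset (ℕ × ℕ) := {(0, 0), (M, 0), (0, M), (M, M)} with hs
  have hle : ∀ i ∈ s, TestFun.seminorms i φ ≤ (s.sup TestFun.seminorms) φ := fun i hi =>
    (Finset.le_sup (f := TestFun.seminorms) hi : TestFun.seminorms i ≤ _) φ
  have b : ∀ n : ℤ, (1 + |(n : ℝ)|) ^ M ≤ 2 ^ M * (1 + |(n : ℝ)| ^ M) := by
    intro n
    rcases le_total |(n : ℝ)| 1 with h | h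
    · calc (1 + |(n : ℝ)|) ^ M ≤ 2 ^ M := pow_le_pow_left₀ (by positivity) (by linarith) M
        _ ≤ _ := le_mul_of_one_le_right (by positivity)
            (by linarith [pow_nonneg (abs_nonneg (n : ℝ)) M])
    · calc (1 + |(n : ℝ)|) ^ M ≤ (2 * |(n : ℝ)|) ^ M :=
            pow_le_pow_left₀ (by positivity) (by linarith) M
        _ = 2 ^ M * |(n : ℝ)| ^ M := mul_pow _ _ _
        _ ≤ _ := by gcongr; linarith
  have h00 := (TestFun.norm_fourier_mul_le 0 0 k φ).trans (hle (0, 0) (by simp [hs]))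
  have h10 := (TestFun.norm_fourier_mul_le M 0 k φ).trans (hle (M, 0) (by simp [hs]))
  have h01 := (TestFun.norm_fourier_mul_le 0 M k φ).trans (hle (0, M) (by simp [hs]))
  have h11 := (TestFun.norm_fourier_mul_le M M k φ).trans (hle (M, M) (by simp [hs]))
  simp only [pow_zero, mul_one, one_mul] at h00 h10 h01 h11
  calc (1 + |(k.1 : ℝ)|) ^ M * (1 + |(k.2 : ℝ)|) ^ M * ‖TestFun.fourier k φ‖
      ≤ (2 ^ M * (1 + |(k.1 : ℝ)| ^ M)) * (2 ^ M * (1 + |(k.2 : ℝ)| ^ M))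
          * ‖TestFun.fourier k φ‖ :=
        mul_le_mul_of_nonneg_right (mul_le_mul (b _) (b _) (by positivity) (by positivity))
          (norm_nonneg _)
    _ = 4 ^ M * (‖TestFun.fourier k φ‖ + |(k.1 : ℝ)| ^ M * ‖TestFun.fourier k φ‖
          + |(k.2 : ℝ)| ^ M * ‖TestFun.fourier k φ‖
          + |(k.1 : ℝ)| ^ M * |(k.2 : ℝ)| ^ M * ‖TestFun.fourier k φ‖) := by
        rw [show (4 : ℝ) ^ M = 2 ^ M * 2 ^ M by rw [← mul_pow]; norm_num]; ring
    _ ≤ 4 ^ M * (4 * (s.sup TestFun.seminorms) φ) := by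
        refine mul_le_mul_of_nonneg_left ?_ (by positivity)
        linarith
    _ = _ := by ring

theorem term_bound (f : PerDistr) {m : ℤ × ℤ → ℂ} (hm : ∃ C, ∀ k, ‖m k‖ ≤ C) :
    ∃ (K : ℝ≥0) (s : Finset (ℕ × ℕ)), ∀ (k : ℤ × ℤ) (φ : TestFun),
      ‖m k * f.coeff k * TestFun.fourier (-k) φ‖
        ≤ K * (s.sup TestFun.seminorms) φ * weight k := by
  obtain ⟨C, hC⟩ := hm
  obtain ⟨K, N, hK, hf⟩ := f.growth
  have hC0 : 0 ≤ C := (norm_nonneg _).trans (hC 0)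
  refine ⟨⟨C * K * (4 ^ (N + 2) * 4), by positivity⟩,
    {(0, 0), (N + 2, 0), (0, N + 2), (N + 2, N + 2)}, fun k φ => ?_⟩
  have hd := decay (N + 2) φ (-k)
  set S := (({(0, 0), (N + 2, 0), (0, N + 2), (N + 2, N + 2)} : Finset (ℕ × ℕ)).sup
    TestFun.seminorms) φ
  simp only [Prod.fst_neg, Prod.snd_neg, Int.cast_neg, abs_neg] at hd
  have hw : 0 < (1 + |(k.1 : ℝ)|) ^ 2 * (1 + |(k.2 : ℝ)|) ^ 2 := by positivity
  have hwt : weight k = 1 / ((1 + |(k.1 : ℝ)|) ^ 2 * (1 + |(k.2 : ℝ)|) ^ 2) := by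
    rw [weight, one_div_mul_one_div]
  rw [hwt, mul_one_div, le_div_iff₀ hw, norm_mul, norm_mul]
  change _ ≤ C * K * (4 ^ (N + 2) * 4) * S
  calc ‖m k‖ * ‖f.coeff k‖ * ‖TestFun.fourier (-k) φ‖
        * ((1 + |(k.1 : ℝ)|) ^ 2 * (1 + |(k.2 : ℝ)|) ^ 2)
      ≤ C * (K * ((1 + |(k.1 : ℝ)|) ^ N * (1 + |(k.2 : ℝ)|) ^ N)) * ‖TestFun.fourier (-k) φ‖
        * ((1 + |(k.1 : ℝ)|) ^ 2 * (1 + |(k.2 : ℝ)|) ^ 2) := by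
        gcongr
        · exact hC k
        · exact hf k
    _ = C * K * ((1 + |(k.1 : ℝ)|) ^ (N + 2) * (1 + |(k.2 : ℝ)|) ^ (N + 2)
          * ‖TestFun.fourier (-k) φ‖) := by ring
    _ ≤ C * K * (4 ^ (N + 2) * 4 * S) := mul_le_mul_of_nonneg_left hd (by positivity)
    _ = _ := by ring

theorem summable_term (f : PerDistr) {m : ℤ × ℤ → ℂ} (hm : ∃ C, ∀ k, ‖m k‖ ≤ C) (φ : TestFun) :
    Summable fun k => m k * f.coeff k * TestFun.fourier (-k) φ := by
  obtain ⟨K, s, h⟩ := f.term_bound hm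
  exact Summable.of_norm_bounded (summable_weight.mul_left _) fun k => h k φ

/-- The functional `φ ↦ ∑ₖ m(k) f(k) ∫_{[0,1)²} exp(2πi k·x) φ(x) dx`. -/
def multiplierPairing (m : ℤ × ℤ → ℂ) (hm : ∃ C, ∀ k, ‖m k‖ ≤ C) (f : PerDistr) :
    TestFun →ₗ[ℂ] ℂ where
  toFun φ := ∑' k, m k * f.coeff k * TestFun.fourier (-k) φ
  map_add' φ ψ := by
    simp_rw [map_add, mul_add]
    exact (f.summable_term hm φ).tsum_add (f.summable_term hm ψ)
  map_smul' c φ := by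
    simp_rw [map_smul, smul_eq_mul, mul_left_comm _ c]
    exact tsum_mul_left

theorem continuous_multiplierPairing (m : ℤ × ℤ → ℂ) (hm : ∃ C, ∀ k, ‖m k‖ ≤ C)
    (f : PerDistr) : Continuous (multiplierPairing m hm f) := by
  obtain ⟨K, s, h⟩ := f.term_bound hm
  refine TestFun.continuous_functional _ s (K * (∑' k, weight k).toNNReal) fun φ => ?_
  have h0 : 0 ≤ ∑' k, weight k := tsum_nonneg fun k => by unfold weight; positivity
  have := tsum_of_norm_bounded (summable_weight.hasSum.mul_left
    (K * (s.sup TestFun.seminorms) φ)) fun k => h k φ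
  refine this.trans (le_of_eq ?_)
  push_cast
  rw [Real.coe_toNNReal _ h0]
  ring

/-- The Fourier multiplier with bounded symbol `m`: it multiplies the Fourier coefficient of a
periodic distribution at the frequency `2πk` with `m k`. -/
def multiplier (m : ℤ × ℤ → ℂ) (hm : ∃ C, ∀ k, ‖m k‖ ≤ C) (f : PerDistr) : PerDistr :=
  ⟨multiplierPairing m hm f, continuous_multiplierPairing m hm f⟩

theorem coeff_multiplier (m : ℤ × ℤ → ℂ) (hm : ∃ C, ∀ k, ‖m k‖ ≤ C) (f : PerDistr) (k : ℤ × ℤ) :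
    (multiplier m hm f).coeff k = m k * f.coeff k := by
  change ∑' l, m l * f.coeff l * TestFun.fourier (-l) (TestFun.expo (-k)) = _
  rw [tsum_eq_single k]
  · simp [TestFun.fourier_expo]
  · intro l hl
    rw [TestFun.fourier_expo, if_neg (by simpa using hl), mul_zero]

/-- The symbol `i sgn(k₁)` of the Hilbert transform in `x₁`. -/
def hilbertSymbol (k : ℤ × ℤ) : ℂ := Complex.I * (k.1.sign : ℂ)

/-- The symbol `|k₁|⁻¹` at the frequency `2πk`, with the value `0` for `k₁ = 0`. -/
def absInvSymbol (k : ℤ × ℤ) : ℂ := if k.1 = 0 then 0 else ((2 * Real.pi * |(k.1 : ℝ)|)⁻¹ : ℝ)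

theorem hilbertSymbol_bounded : ∃ C, ∀ k, ‖hilbertSymbol k‖ ≤ C := by
  refine ⟨1, fun k => ?_⟩
  rw [hilbertSymbol, norm_mul, Complex.norm_I, one_mul]
  rcases lt_trichotomy k.1 0 with h | h | h
  · simp [Int.sign_eq_neg_one_of_neg h]
  · simp [h]
  · simp [Int.sign_eq_one_of_pos h]

theorem absInvSymbol_bounded : ∃ C, ∀ k, ‖absInvSymbol k‖ ≤ C := by
  refine ⟨1, fun k => ?_⟩
  unfold absInvSymbol
  split_ifs with h
  · simp
  · have h1 : (1 : ℝ) ≤ |(k.1 : ℝ)| := by exact_mod_cast Int.one_le_abs h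
    have h2 : (1 : ℝ) ≤ 2 * Real.pi * |(k.1 : ℝ)| := by nlinarith [Real.pi_gt_three]
    rw [Complex.norm_real, Real.norm_of_nonneg (by positivity)]
    exact inv_le_one_of_one_le₀ h2

/-- The Hilbert transform `R = ∂₁ |∂₁|⁻¹` in the first variable. -/
def hilbert (f : PerDistr) : PerDistr := multiplier hilbertSymbol hilbertSymbol_bounded f

/-- The operator `|∂₁|⁻¹`. -/
def absInv (f : PerDistr) : PerDistr := multiplier absInvSymbol absInvSymbol_bounded f

/-- The operator `ℒ = -∂₁² - |∂₁|⁻¹ ∂₂²`. -/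
def opL (f : PerDistr) : PerDistr := -(d1 (d1 f)) - absInv (d2 (d2 f))

/-- Vanishing average in `x₁`: `f` vanishes on all test functions that depend on `x₂` only. -/
def HasZeroX1Average (f : PerDistr) : Prop :=
  ∀ φ : TestFun, (∀ x : ℝ × ℝ, φ x = φ (0, x.2)) → f φ = 0

end PerDistr

/-! ### The anisotropic Hölder scale -/

/-- The anisotropic distance `d(x,y) = |x₁ - y₁| + |x₂ - y₂|^{2/3}`. -/
def aDist (x y : ℝ × ℝ) : ℝ := |x.1 - y.1| + |x.2 - y.2| ^ (2 / 3 : ℝ)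

/-- The Hölder seminorm `[u]_α` of a periodic function, for `0 < α < 3/2`, with values in `[0,∞]`.
(If it is finite for an `α > 1`, then `u` is differentiable in `x₁`.) -/
def holder (α : ℝ) (u : ℝ × ℝ → ℂ) : ℝ≥0∞ :=
  if α ≤ 1 then
    ⨆ (x : ℝ × ℝ) (y : ℝ × ℝ) (_ : x ≠ y), ENNReal.ofReal (‖u y - u x‖ / aDist y x ^ α)
  else
    ⨆ (x : ℝ × ℝ) (y : ℝ × ℝ) (_ : x ≠ y),
      ENNReal.ofReal
        (‖u y - u x - deriv (fun t : ℝ => u (t, x.2)) x.1 * ((y.1 - x.1 : ℝ) : ℂ)‖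
          / aDist y x ^ α)

/-- The seminorm `[f]_α`, `0 < α < 3/2`, of a periodic distribution: that of the function that
represents `f`, and `∞` if `f` is not represented by a function of class `C^α`.
(A function with finite seminorm is continuous, so that at most one of them represents `f`.) -/
def holderPos (α : ℝ) (f : PerDistr) : ℝ≥0∞ :=
  ⨅ (u : PerFun) (_ : u.toDistr = f), holder α u

/-- The norm `[f]_β`, `-3/2 < β < 0`, of a periodic distribution; it is `∞` if there is no
decomposition of the required form. -/
def holderNeg (β : ℝ) (f : PerDistr) : ℝ≥0∞ :=
  if -1 < β then
    ⨅ (c : ℂ) (g : PerFun) (h : PerFun)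
      (_ : f = (PerFun.const c).toDistr + g.toDistr.d1 + h.toDistr.d2),
      ENNReal.ofReal ‖c‖ + holder (β + 1) g + holder (β + 3 / 2) h
  else
    ⨅ (c : ℂ) (g : PerFun) (h : PerFun)
      (_ : f = (PerFun.const c).toDistr + g.toDistr.d1.d1 + h.toDistr.d2),
      ENNReal.ofReal ‖c‖ + holder (β + 2) g + holder (β + 3 / 2) h

end AnisoTorus

end

/-!
The operator `|∂₁|ℒ` has the symbol `|k₁|³ + k₂²`, so that the semigroup
`Sₜ = exp(-t(|∂₁|³ - ∂₂²))` satisfies `-d/dt Sₜf = Sₜ|∂₁|ℒf`. For `ℒf = c + ∂₁ᵉg + ∂₂h` with Hölder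
functions `g` and `h`, the right-hand side consists of multipliers with integrable kernels, applied
to `g` and `h`. Their symbols contain the factor `|k₁|`, so that they annihilate constants
and only increments of `g` and `h` matter. Hence the moments of the kernels, which scale with `t`
according to the distance `d`, bound the derivative `∂₁ⁱ∂₂ʲ` of the right-hand side by a constant
times `t ^ ((α - i) / 3 - j / 2 - 1)`. The kernels are estimated from their Fourier coefficients,
by summation by parts.

Integrating in `t`, the functions `Sₜf` converge uniformly to `f` with the error `t ^ (α / 3)`,
while their derivatives of order beyond `α` are bounded by negative powers of `t`. Splitting an
increment of `f` between `x` and `y` at the scale `t = d(x,y)³` gives the Hölder estimate. As `R`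
only changes the multipliers by the factor `i sgn(k₁)`, `Rf` is treated in the same way.
-/

open Set Filter Asymptotics Topology

noncomputable section

namespace AnisoTorus

/-! ### Symbols on the integers -/

theorem norm_second_difference_le {E : Type*} [NormedAddCommGroup E] [NormedSpace ℝ E]
    {f : ℝ → E} (hf : ContDiff ℝ 2 f) {x h B : ℝ} (hh : 0 ≤ h)
    (hB : ∀ y ∈ Icc (x - h) (x + h), ‖iteratedDeriv 2 f y‖ ≤ B) :
    ‖f (x + h) - (2 : ℝ) • f x + f (x - h)‖ ≤ 2 * B * h ^ 2 := by
  have hf' : Differentiable ℝ (deriv f) :=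
    (hf.deriv' (n := 1)).differentiable one_ne_zero
  have deriv_diff_le : ∀ s ∈ Icc 0 h, ‖deriv f (x + s) - deriv f (x - s)‖ ≤ 2 * B * h := by
    intro s hs
    have hB0 : 0 ≤ B := (norm_nonneg _).trans (hB x ⟨by linarith, by linarith⟩)
    have := (convex_Icc (x - h) (x + h)).norm_image_sub_le_of_norm_deriv_le
      (fun y _ => hf' y) (fun y hy => by simpa [iteratedDeriv_succ] using hB y hy)
      (x := x - s) (y := x + s) ⟨by linarith [hs.2], by linarith [hs.1]⟩
      ⟨by linarith [hs.1], by linarith [hs.2]⟩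
    rw [show x + s - (x - s) = 2 * s by ring, Real.norm_of_nonneg (by linarith [hs.1])] at this
    nlinarith [hs.2]
  have hasDerivAt_sum : ∀ s, HasDerivAt (fun s => f (x + s) + f (x - s))
      (deriv f (x + s) - deriv f (x - s)) s := fun s => by
    have hd := fun y => (hf.differentiable two_ne_zero y).hasDerivAt
    exact (((hd (x + s)).comp_const_add x s).add ((hd (x - s)).comp_const_sub x s)).congr_deriv
      (sub_eq_add_neg _ _).symm
  have := (convex_Icc 0 h).norm_image_sub_le_of_norm_hasDerivWithin_le
    (fun s _ => (hasDerivAt_sum s).hasDerivWithinAt) deriv_diff_le ⟨le_rfl, hh⟩ ⟨hh, le_rfl⟩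
  simp only [add_zero, sub_zero, Real.norm_of_nonneg hh] at this
  rw [show f (x + h) - (2 : ℝ) • f x + f (x - h) = f (x + h) + f (x - h) - (f x + f x) by
    rw [two_smul]; abel]
  linarith

/-- Functions that decay quadratically on `[0,∞)` together with their first two derivatives. The
Fourier multipliers of the proof have symbols of this form in `|k₁|` and `|k₂|`. -/
structure IsProfile (f : ℝ → ℝ) : Prop where
  contDiff : ContDiff ℝ 2 f
  isBigO : ∀ i ≤ 2, iteratedDeriv i f =O[𝓟 (Ici 0)] fun ξ => ((1 + ξ) ^ 2)⁻¹

theorem IsProfile.exists_bound {f : ℝ → ℝ} (hf : IsProfile f) :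
    ∃ A, 0 ≤ A ∧ ∀ i ≤ 2, ∀ ξ, 0 ≤ ξ → |iteratedDeriv i f ξ| ≤ A * ((1 + ξ) ^ 2)⁻¹ := by
  have bound : ∀ i : Fin 3, ∃ A, ∀ ξ, 0 ≤ ξ → |iteratedDeriv i f ξ| ≤ A * ((1 + ξ) ^ 2)⁻¹ :=
    fun i => by
      obtain ⟨A, hA⟩ := isBigO_principal.1 (hf.isBigO i (by omega))
      exact ⟨A, fun ξ hξ => by simpa using hA ξ hξ⟩
  choose A hA using bound
  refine ⟨∑ i, |A i|, by positivity, fun i hi ξ hξ => ?_⟩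
  refine (hA ⟨i, by omega⟩ ξ hξ).trans (mul_le_mul_of_nonneg_right ?_ (by positivity))
  exact (le_abs_self _).trans
    (Finset.single_le_sum (fun j _ => abs_nonneg (A j)) (Finset.mem_univ _))

/-- The function `ξ ↦ ξ^j exp(-ξ^p)`, in terms of which the derivatives of the semigroup
`exp(-t(|∂₁|³ - ∂₂²))` are expressed. -/
def powMulExp (p j : ℕ) (ξ : ℝ) : ℝ := ξ ^ j * Real.exp (-ξ ^ p)

theorem contDiff_powMulExp (p j : ℕ) {n : WithTop ℕ∞} : ContDiff ℝ n (powMulExp p j) := by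
  unfold powMulExp; fun_prop

theorem deriv_powMulExp (p j : ℕ) :
    deriv (powMulExp p j)
      = fun ξ => j * powMulExp p (j - 1) ξ - p * powMulExp p (j + (p - 1)) ξ := by
  ext ξ
  refine (((hasDerivAt_pow j ξ).mul (hasDerivAt_pow p ξ).neg.exp).congr_deriv ?_).deriv
  simp only [powMulExp, Pi.neg_apply, pow_add]
  ring

theorem pow_mul_exp_neg_le {ξ : ℝ} (hξ : 0 ≤ ξ) (i : ℕ) :
    ξ ^ i * Real.exp (-ξ) ≤ i.factorial := by
  have := Real.pow_div_factorial_le_exp ξ hξ i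
  rw [div_le_iff₀ (by positivity)] at this
  rw [Real.exp_neg, ← div_eq_mul_inv, div_le_iff₀ (Real.exp_pos _)]
  linarith

theorem powMulExp_isBigO {p : ℕ} (hp : p ≠ 0) (j : ℕ) :
    powMulExp p j =O[𝓟 (Ici 0)] fun ξ => ((1 + ξ) ^ 2)⁻¹ := by
  refine isBigO_principal.2
    ⟨Real.exp 1 * (2 * (j.factorial + (j + 2).factorial)), fun ξ (hξ : 0 ≤ ξ) => ?_⟩
  have sub_one_le_pow : ξ - 1 ≤ ξ ^ p := by
    rcases le_total ξ 1 with h | h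
    · linarith [pow_nonneg hξ p]
    · linarith [le_self_pow₀ h hp]
  have exp_le : Real.exp (-ξ ^ p) ≤ Real.exp 1 * Real.exp (-ξ) := by
    rw [← Real.exp_add]; exact Real.exp_le_exp.2 (by linarith)
  rw [Real.norm_of_nonneg (by unfold powMulExp; positivity), Real.norm_of_nonneg (by positivity),
    ← div_eq_mul_inv, le_div_iff₀ (by positivity), powMulExp]
  calc ξ ^ j * Real.exp (-ξ ^ p) * (1 + ξ) ^ 2
      ≤ ξ ^ j * (Real.exp 1 * Real.exp (-ξ)) * (2 * (1 + ξ ^ 2)) := by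
        gcongr
        nlinarith [sq_nonneg (ξ - 1)]
    _ = Real.exp 1 * (2 * (ξ ^ j * Real.exp (-ξ) + ξ ^ (j + 2) * Real.exp (-ξ))) := by ring
    _ ≤ _ := by gcongr <;> exact pow_mul_exp_neg_le hξ _

theorem iteratedDeriv_powMulExp_isBigO {p : ℕ} (hp : p ≠ 0) (i j : ℕ) :
    iteratedDeriv i (powMulExp p j) =O[𝓟 (Ici 0)] fun ξ => ((1 + ξ) ^ 2)⁻¹ := by
  induction i generalizing j with
  | zero => simpa only [iteratedDeriv_zero] using powMulExp_isBigO hp j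
  | succ i ih =>
    have smooth := fun (a : ℝ) j (ξ : ℝ) =>
      ((contDiff_powMulExp p j (n := i)).const_smul a).contDiffAt (x := ξ)
    have : iteratedDeriv (i + 1) (powMulExp p j) = fun ξ =>
        j * iteratedDeriv i (powMulExp p (j - 1)) ξ
          - p * iteratedDeriv i (powMulExp p (j + (p - 1))) ξ := by
      ext ξ
      rw [iteratedDeriv_succ', deriv_powMulExp]
      refine (iteratedDeriv_fun_sub (smooth j _ ξ) (smooth p _ ξ)).trans ?_
      simp only [smul_eq_mul, iteratedDeriv_const_mul_field]
    rw [this]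
    exact ((ih _).const_mul_left _).sub ((ih _).const_mul_left _)

theorem isProfile_powMulExp {p : ℕ} (hp : p ≠ 0) (j : ℕ) : IsProfile (powMulExp p j) :=
  ⟨contDiff_powMulExp p j, fun i _ => iteratedDeriv_powMulExp_isBigO hp i j⟩

theorem powMulExp_zero (p : ℕ) {j : ℕ} (hj : j ≠ 0) : powMulExp p j 0 = 0 := by
  simp [powMulExp, hj]

theorem exists_hasSum_nat_inv_sq {r : ℝ} (hr : 0 < r) :
    ∃ S ≤ r⁻¹, HasSum (fun n : ℕ => ((1 + r * (n + 1)) ^ 2)⁻¹) S := by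
  have le_sub : ∀ n : ℕ, ((1 + r * (n + 1)) ^ 2)⁻¹
      ≤ r⁻¹ * (1 + r * n)⁻¹ - r⁻¹ * (1 + r * (n + 1 : ℕ))⁻¹ := fun n => by
    have : r⁻¹ * (1 + r * n)⁻¹ - r⁻¹ * (1 + r * (n + 1 : ℕ))⁻¹
        = ((1 + r * n) * (1 + r * (n + 1)))⁻¹ := by
      push_cast; field_simp; ring
    rw [this, sq]
    gcongr
    linarith
  have sum_le : ∀ N : ℕ, ∑ n ∈ Finset.range N, ((1 + r * ((n : ℝ) + 1)) ^ 2)⁻¹ ≤ r⁻¹ := fun N => by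
    refine (Finset.sum_le_sum fun n _ => le_sub n).trans ?_
    rw [Finset.sum_range_sub']
    have : 0 ≤ r⁻¹ * (1 + r * (N : ℝ))⁻¹ := by positivity
    simpa using this
  exact ⟨_, Real.tsum_le_of_sum_range_le (fun n => by positivity) sum_le,
    (summable_of_sum_range_le (fun n => by positivity) sum_le).hasSum⟩

theorem exists_hasSum_int_inv_sq {r : ℝ} (hr : 0 < r) :
    ∃ S ≤ 1 + 2 * r⁻¹, HasSum (fun n : ℤ => ((1 + r * |(n : ℝ)|) ^ 2)⁻¹) S := by
  obtain ⟨S, hS, hasSum_succ⟩ := exists_hasSum_nat_inv_sq hr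
  have hasSum_nat : HasSum (fun n : ℕ => ((1 + r * |((n : ℤ) : ℝ)|) ^ 2)⁻¹) (S + 1) := by
    rw [← hasSum_nat_add_iff' 1]
    simpa [abs_of_nonneg (Nat.cast_add_one_pos (α := ℝ) _).le] using hasSum_succ
  have hasSum_neg : HasSum (fun n : ℕ => ((1 + r * |((-((n : ℤ) + 1) : ℤ) : ℝ)|) ^ 2)⁻¹) S := by
    refine hasSum_succ.congr_fun fun n => ?_
    rw [Int.cast_neg, abs_neg, abs_of_nonneg (by positivity)]
    simp
  exact ⟨S + 1 + S, by linarith, HasSum.of_nat_of_neg_add_one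
    (f := fun n : ℤ => ((1 + r * |(n : ℝ)|) ^ 2)⁻¹) hasSum_nat hasSum_neg⟩

/-- Bounds on a sequence of Fourier coefficients which make the periodic function with these
coefficients a kernel at the length scale `r`: its size is at most `C (1 + r⁻¹)`, and the second
differences of the coefficients, which are the coefficients of the kernel times `-4 sin²(πz)`,
control its decay. At scales above the period only the size matters. -/
structure IsKernelSymbol (C r : ℝ) (m : ℤ → ℂ) : Prop where
  pos : 0 < r
  summable_norm : Summable fun n => ‖m n‖
  tsum_norm_le : ∑' n, ‖m n‖ ≤ C * (1 + r⁻¹)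
  tsum_norm_diff_le : r ≤ 1 → ∑' n, ‖m (n + 1) - 2 * m n + m (n - 1)‖ ≤ C * r

theorem IsKernelSymbol.nonneg {C r : ℝ} {m : ℤ → ℂ} (h : IsKernelSymbol C r m) : 0 ≤ C := by
  have := h.pos
  exact nonneg_of_mul_nonneg_left ((tsum_nonneg fun n => norm_nonneg (m n)).trans h.tsum_norm_le)
    (by positivity)

/-- A profile sampled at the length scale `r`, with a factor depending on the sign of the
frequency: `i sgn` for `R` and for odd derivatives, `1` otherwise. -/
def signedSymbol (σ : ℤ → ℂ) (f : ℝ → ℝ) (r : ℝ) (n : ℤ) : ℂ := σ n.sign * f (r * |(n : ℝ)|)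

section signedSymbol

variable {σ : ℤ → ℂ} {f : ℝ → ℝ} {r : ℝ}

theorem signedSymbol_of_sign (hσ₀ : ∀ n, σ n * f 0 = σ 0 * f 0) {s n : ℤ} (hs : |s| = 1)
    (hn : 0 ≤ s * n) : signedSymbol σ f r n = σ s * f (r * (s * n)) := by
  rcases eq_or_ne n 0 with rfl | hn0
  · simp [signedSymbol, hσ₀ s]
  · have : n.sign = s := by
      rcases (abs_eq zero_le_one).1 hs with rfl | rfl
      · exact Int.sign_eq_one_of_pos (by omega)
      · exact Int.sign_eq_neg_one_of_neg (by omega)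
    rw [signedSymbol, this, ← this, ← Int.cast_mul, ← Int.cast_abs, Int.sign_mul_self_eq_abs]

theorem norm_signedSymbol_le {A : ℝ} (hσ : ∀ n, ‖σ n‖ ≤ 1)
    (hf : ∀ ξ, 0 ≤ ξ → |f ξ| ≤ A * ((1 + ξ) ^ 2)⁻¹) (hr : 0 ≤ r) (n : ℤ) :
    ‖signedSymbol σ f r n‖ ≤ A * ((1 + r * |(n : ℝ)|) ^ 2)⁻¹ := by
  rw [signedSymbol, norm_mul, Complex.norm_real, Real.norm_eq_abs]
  exact (mul_le_of_le_one_left (abs_nonneg _) (hσ _)).trans (hf _ (by positivity))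

theorem norm_signedSymbol_second_difference_le (hf : ContDiff ℝ 2 f) {A : ℝ} (hA0 : 0 ≤ A)
    (hA : ∀ ξ, 0 ≤ ξ → |iteratedDeriv 2 f ξ| ≤ A * ((1 + ξ) ^ 2)⁻¹) (hσ : ∀ n, ‖σ n‖ ≤ 1)
    (hσ₀ : ∀ n, σ n * f 0 = σ 0 * f 0) (hr : 0 < r) (hr1 : r ≤ 1) {n : ℤ} (hn : n ≠ 0) :
    ‖signedSymbol σ f r (n + 1) - 2 * signedSymbol σ f r n + signedSymbol σ f r (n - 1)‖
      ≤ 8 * A * r ^ 2 * ((1 + r * |(n : ℝ)|) ^ 2)⁻¹ := by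
  obtain ⟨s, hs, hsn⟩ : ∃ s : ℤ, |s| = 1 ∧ s * n = |n| :=
    ⟨n.sign, by rw [Int.abs_sign_of_ne_zero hn], Int.sign_mul_self_eq_abs n⟩
  have one_le_abs : 1 ≤ |n| := Int.one_le_abs hn
  have second_difference_eq :
      signedSymbol σ f r (n + 1) - 2 * signedSymbol σ f r n + signedSymbol σ f r (n - 1)
        = σ s * ((f (r * |(n : ℝ)| + r) - (2 : ℝ) • f (r * |(n : ℝ)|)
          + f (r * |(n : ℝ)| - r) : ℝ) : ℂ) := by
    have hsn' : (s : ℝ) * n = |(n : ℝ)| := by exact_mod_cast hsn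
    rcases (abs_eq zero_le_one).1 hs with hs' | hs' <;>
    · rw [signedSymbol_of_sign hσ₀ hs (n := n + 1) (by subst hs'; linarith),
        signedSymbol_of_sign hσ₀ hs (n := n) (by omega),
        signedSymbol_of_sign hσ₀ hs (n := n - 1) (by subst hs'; linarith)]
      push_cast
      rw [mul_add, mul_sub, hsn', hs']
      simp only [mul_add, mul_sub, smul_eq_mul]
      push_cast
      ring_nf
  rw [second_difference_eq, norm_mul, Complex.norm_real]
  have hx : 1 ≤ |(n : ℝ)| := by exact_mod_cast one_le_abs
  refine (mul_le_of_le_one_left (norm_nonneg _) (hσ _)).trans ?_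
  refine (norm_second_difference_le hf hr.le (B := 4 * A * ((1 + r * |(n : ℝ)|) ^ 2)⁻¹)
    fun y hy => ?_).trans (le_of_eq (by ring))
  have hy0 : 0 ≤ y := le_trans (by nlinarith) hy.1
  refine (hA y hy0).trans ?_
  rw [mul_comm 4, mul_assoc]
  gcongr
  rw [← div_eq_mul_inv, ← one_div, div_le_div_iff₀ (by positivity) (by positivity)]
  have : (1 + r * |(n : ℝ)|) ^ 2 ≤ (2 * (1 + y)) ^ 2 := by
    gcongr
    linarith [hy.1]
  linarith

theorem norm_signedSymbol_second_difference_zero_le (hf : Differentiable ℝ f) {A : ℝ}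
    (hA : ∀ ξ, 0 ≤ ξ → |deriv f ξ| ≤ A) (hσ : ∀ n, ‖σ n‖ ≤ 1)
    (hσ₀ : ∀ n, σ n * f 0 = σ 0 * f 0) (hr : 0 ≤ r) :
    ‖signedSymbol σ f r 1 - 2 * signedSymbol σ f r 0 + signedSymbol σ f r (-1)‖ ≤ 2 * A * r := by
  have abs_sub_le : |f r - f 0| ≤ A * r := by
    simpa [abs_of_nonneg hr] using (convex_Ici 0).norm_image_sub_le_of_norm_deriv_le
      (fun ξ _ => hf ξ) hA self_mem_Ici hr
  have second_difference_eq :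
      signedSymbol σ f r 1 - 2 * signedSymbol σ f r 0 + signedSymbol σ f r (-1)
        = σ 1 * (f r - f 0 : ℝ) + σ (-1) * (f r - f 0 : ℝ) := by
    simp only [signedSymbol, Int.sign_one, Int.sign_zero, Int.sign_neg, Int.cast_one, Int.cast_neg,
      Int.cast_zero, abs_neg, abs_one, abs_zero, mul_one, mul_zero, Complex.ofReal_sub]
    linear_combination hσ₀ 1 + hσ₀ (-1)
  rw [second_difference_eq]
  have norm_le : ∀ n, ‖σ n * (f r - f 0 : ℝ)‖ ≤ A * r := fun n => by
    rw [norm_mul, Complex.norm_real]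
    exact (mul_le_of_le_one_left (norm_nonneg _) (hσ n)).trans abs_sub_le
  linarith [norm_add_le (σ 1 * ((f r - f 0 : ℝ) : ℂ)) (σ (-1) * ((f r - f 0 : ℝ) : ℂ)), norm_le 1,
    norm_le (-1)]

end signedSymbol

theorem IsProfile.exists_isKernelSymbol {f : ℝ → ℝ} (hf : IsProfile f) :
    ∃ C, ∀ (σ : ℤ → ℂ) (r : ℝ), (∀ n, ‖σ n‖ ≤ 1) → (∀ n, σ n * f 0 = σ 0 * f 0) → 0 < r →
      IsKernelSymbol C r (signedSymbol σ f r) := by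
  obtain ⟨A, hA0, hA⟩ := hf.exists_bound
  refine ⟨26 * A, fun σ r hσ hσ₀ hr => ?_⟩
  obtain ⟨S, hS, hasSum⟩ := exists_hasSum_int_inv_sq hr
  have norm_le := norm_signedSymbol_le hσ
    (fun ξ hξ => by simpa only [iteratedDeriv_zero] using hA 0 zero_le_two ξ hξ) hr.le
  have summable_norm : Summable fun n => ‖signedSymbol σ f r n‖ :=
    (hasSum.summable.mul_left A).of_nonneg_of_le (fun _ => norm_nonneg _) norm_le
  refine ⟨hr, summable_norm, ?_, fun hr1 => ?_⟩
  · refine (summable_norm.tsum_le_tsum norm_le (hasSum.summable.mul_left A)).trans ?_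
    rw [(hasSum.mul_left A).tsum_eq]
    have : 0 ≤ r⁻¹ := by positivity
    nlinarith
  · have diff_le : ∀ n : ℤ, ‖signedSymbol σ f r (n + 1) - 2 * signedSymbol σ f r n
        + signedSymbol σ f r (n - 1)‖
        ≤ 8 * A * r ^ 2 * ((1 + r * |(n : ℝ)|) ^ 2)⁻¹ + if n = 0 then 2 * A * r else 0 := by
      intro n
      split_ifs with hn
      · subst hn
        refine le_add_of_nonneg_of_le (by positivity) ?_
        refine norm_signedSymbol_second_difference_zero_le (hf.contDiff.differentiable two_ne_zero)
          (fun ξ hξ => ?_) hσ hσ₀ hr.le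
        have : |deriv f ξ| ≤ A * ((1 + ξ) ^ 2)⁻¹ := by
          simpa only [iteratedDeriv_one] using hA 1 one_le_two ξ hξ
        exact this.trans (mul_le_of_le_one_right hA0 (inv_le_one_of_one_le₀
          (one_le_pow₀ (by linarith))))
      · rw [add_zero]
        exact norm_signedSymbol_second_difference_le hf.contDiff hA0 (hA 2 le_rfl) hσ hσ₀ hr hr1 hn
    have hasSum_bound := (hasSum.mul_left (8 * A * r ^ 2)).add (hasSum_ite_eq (0 : ℤ) (2 * A * r))
    refine (Summable.tsum_le_tsum diff_le (hasSum_bound.summable.of_nonneg_of_le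
      (fun _ => norm_nonneg _) diff_le) hasSum_bound.summable).trans ?_
    rw [hasSum_bound.tsum_eq]
    calc 8 * A * r ^ 2 * S + 2 * A * r ≤ 8 * A * r ^ 2 * (1 + 2 * r⁻¹) + 2 * A * r := by gcongr
      _ = A * r * (18 + 8 * r) := by field_simp; ring
      _ ≤ A * r * 26 := by gcongr; linarith
      _ = 26 * A * r := by ring

/-! ### Periodic kernels -/

/-- The convolution kernel, on the circle of length `1`, of the Fourier multiplier with the symbol
`m`. -/
def kernel (m : ℤ → ℂ) (z : UnitAddCircle) : ℂ := ∑' n, m n * fourier n z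

theorem norm_fourier_apply (n : ℤ) (z : UnitAddCircle) : ‖fourier n z‖ = 1 := by
  rw [fourier_apply, Circle.norm_coe]

theorem norm_fourier_second_difference (a : ℝ) :
    ‖fourier 1 (a : UnitAddCircle) - 2 + fourier (-1) (a : UnitAddCircle)‖
      = 4 * Real.sin (Real.pi * a) ^ 2 := by
  have fourier_one : fourier 1 (a : UnitAddCircle)
      = Complex.exp (((2 * (Real.pi * a) : ℝ) : ℂ) * Complex.I) := by
    rw [fourier_coe_apply]; congr 1; push_cast; ring
  have fourier_neg_one : fourier (-1) (a : UnitAddCircle)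
      = Complex.exp (-((2 * (Real.pi * a) : ℝ) : ℂ) * Complex.I) := by
    rw [fourier_coe_apply]; congr 1; push_cast; ring
  have : fourier 1 (a : UnitAddCircle) - 2 + fourier (-1) (a : UnitAddCircle)
      = ((-(4 * Real.sin (Real.pi * a) ^ 2) : ℝ) : ℂ) := by
    have := Complex.two_cos ((2 * (Real.pi * a) : ℝ) : ℂ)
    rw [← fourier_one, ← fourier_neg_one, ← Complex.ofReal_cos, Real.cos_two_mul,
      Real.cos_sq'] at this
    push_cast at this ⊢
    linear_combination -this
  rw [this, Complex.norm_real, norm_neg, Real.norm_of_nonneg (by positivity)]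

theorem sixteen_mul_norm_sq_le (z : UnitAddCircle) :
    16 * ‖z‖ ^ 2 ≤ ‖fourier 1 z - 2 + fourier (-1) z‖ := by
  obtain ⟨a, ha, rfl⟩ : ∃ a : ℝ, |a| ≤ 1 / 2 ∧ (a : UnitAddCircle) = z := by
    obtain ⟨a, rfl⟩ := QuotientAddGroup.mk_surjective z
    refine ⟨a - round a, abs_sub_round a, ?_⟩
    rw [AddCircle.coe_sub, sub_eq_self]
    exact (AddCircle.coe_eq_zero_iff 1).2 ⟨round a, by simp⟩
  rw [norm_fourier_second_difference,
    (AddCircle.norm_coe_eq_abs_iff 1 one_ne_zero).2 (by simpa using ha)]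
  have two_mul_le_abs_sin : 2 * |a| ≤ |Real.sin (Real.pi * a)| := by
    have hpi := Real.pi_pos
    have := Real.mul_abs_le_abs_sin (x := Real.pi * a) (by
      rw [abs_mul, abs_of_pos hpi]; nlinarith)
    rwa [abs_mul, abs_of_pos hpi, ← mul_assoc, div_mul_cancel₀ _ hpi.ne'] at this
  have := pow_le_pow_left₀ (by positivity) two_mul_le_abs_sin 2
  rw [sq_abs] at this
  linarith

theorem fourier_second_difference_mul_kernel {m : ℤ → ℂ} (hm : Summable fun n => ‖m n‖)
    (z : UnitAddCircle) :
    (fourier 1 z - 2 + fourier (-1) z) * kernel m z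
      = ∑' n, (m (n + 1) - 2 * m n + m (n - 1)) * fourier n z := by
  have hasSum : HasSum (fun n => m n * fourier n z) (kernel m z) := by
    refine (Summable.of_norm ?_).hasSum
    simpa only [norm_mul, norm_fourier_apply, mul_one] using hm
  have hasSum_succ := (Equiv.addRight (1 : ℤ)).hasSum_iff.2 hasSum
  have hasSum_pred := (Equiv.subRight (1 : ℤ)).hasSum_iff.2 hasSum
  have := ((hasSum_pred.mul_left (fourier 1 z)).sub (hasSum.mul_left 2)).add
    (hasSum_succ.mul_left (fourier (-1) z))
  rw [← sub_mul, ← add_mul] at this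
  refine (this.congr_fun fun n => ?_).tsum_eq.symm
  have fourier_pred : fourier 1 z * fourier (n - 1) z = fourier n z := by
    rw [← fourier_add]; congr 2; ring
  have fourier_succ : fourier (-1) z * fourier (n + 1) z = fourier n z := by
    rw [← fourier_add]; congr 2; ring
  simp only [Function.comp_apply, Equiv.coe_addRight, Equiv.subRight_apply]
  linear_combination -m (n + 1) * fourier_succ - m (n - 1) * fourier_pred

namespace IsKernelSymbol

variable {C r : ℝ} {m : ℤ → ℂ}

theorem continuous_kernel (h : IsKernelSymbol C r m) : Continuous (kernel m) :=
  continuous_tsum (fun n => continuous_const.mul (fourier n).continuous) h.summable_norm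
    fun n z => by rw [norm_mul, norm_fourier_apply, mul_one]

theorem norm_kernel_le (h : IsKernelSymbol C r m) (z : UnitAddCircle) :
    ‖kernel m z‖ ≤ C * (1 + r⁻¹) := by
  refine (tsum_of_norm_bounded h.summable_norm.hasSum fun n => ?_).trans h.tsum_norm_le
  rw [norm_mul, norm_fourier_apply, mul_one]

theorem sq_mul_norm_kernel_le (h : IsKernelSymbol C r m) (hr : r ≤ 1) (z : UnitAddCircle) :
    16 * ‖z‖ ^ 2 * ‖kernel m z‖ ≤ C * r := by
  have summable_diff : Summable fun n => ‖m (n + 1) - 2 * m n + m (n - 1)‖ := by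
    have := h.summable_norm.of_norm
    have summable_succ := (Equiv.addRight (1 : ℤ)).summable_iff.2 this
    have summable_pred := (Equiv.subRight (1 : ℤ)).summable_iff.2 this
    exact ((summable_succ.sub (this.mul_left 2)).add summable_pred).norm
  calc 16 * ‖z‖ ^ 2 * ‖kernel m z‖ ≤ ‖fourier 1 z - 2 + fourier (-1) z‖ * ‖kernel m z‖ :=
        mul_le_mul_of_nonneg_right (sixteen_mul_norm_sq_le z) (norm_nonneg _)
    _ = ‖∑' n, (m (n + 1) - 2 * m n + m (n - 1)) * fourier n z‖ := by
        rw [← norm_mul, fourier_second_difference_mul_kernel h.summable_norm]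
    _ ≤ ∑' n, ‖m (n + 1) - 2 * m n + m (n - 1)‖ :=
        tsum_of_norm_bounded summable_diff.hasSum fun n => by
          rw [norm_mul, norm_fourier_apply, mul_one]
    _ ≤ C * r := h.tsum_norm_diff_le hr

theorem norm_kernel_le_of_le_one (h : IsKernelSymbol C r m) (hr : r ≤ 1) (z : UnitAddCircle) :
    ‖kernel m z‖ ≤ 3 * C * (r⁻¹ * (1 + (‖z‖ / r) ^ 2)⁻¹) := by
  have hr0 := h.pos
  have size : r * ‖kernel m z‖ ≤ 2 * C := by
    calc r * ‖kernel m z‖ ≤ r * (C * (1 + r⁻¹)) := by gcongr; exact h.norm_kernel_le z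
      _ = C * (r + 1) := by field_simp
      _ ≤ 2 * C := by nlinarith [h.nonneg]
  have decay : ‖z‖ ^ 2 / r * ‖kernel m z‖ ≤ C := by
    rw [div_mul_eq_mul_div, div_le_iff₀ hr0]
    nlinarith [h.sq_mul_norm_kernel_le hr z, norm_nonneg (kernel m z), sq_nonneg ‖z‖]
  rw [← mul_inv, ← div_eq_mul_inv, le_div_iff₀ (by positivity)]
  calc ‖kernel m z‖ * (r * (1 + (‖z‖ / r) ^ 2))
      = r * ‖kernel m z‖ + ‖z‖ ^ 2 / r * ‖kernel m z‖ := by field_simp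
    _ ≤ 3 * C := by linarith

end IsKernelSymbol

theorem integrable_abs_rpow_mul_inv {s : ℝ} (h0 : 0 ≤ s) (h1 : s < 1) :
    Integrable fun w : ℝ => |w| ^ s * (1 + |w| ^ 2)⁻¹ := by
  refine (integrable_rpow_neg_one_add_norm_sq (E := ℝ) (μ := volume) (r := 2 - s)
    (by simp; linarith)).mono' ?_ (Filter.Eventually.of_forall fun w => ?_)
  · refine Continuous.aestronglyMeasurable ?_
    refine (continuous_abs.rpow_const fun x => Or.inr h0).mul ?_
    exact Continuous.inv₀ (by fun_prop) fun w => by positivity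
  · have : |w| ^ s ≤ (1 + |w| ^ 2) ^ (s / 2) := by
      calc |w| ^ s = (|w| ^ (2 : ℝ)) ^ (s / 2) := by
            rw [← Real.rpow_mul (abs_nonneg _)]; congr 1; ring
        _ ≤ _ := by gcongr; rw [Real.rpow_two]; linarith
    rw [Real.norm_of_nonneg (by positivity), Real.norm_eq_abs,
      show -(2 - s) / 2 = s / 2 + (-1) by ring, Real.rpow_add (by positivity), Real.rpow_neg_one]
    gcongr

theorem integral_comp_norm_le {F : ℝ → ℝ} (hF : ∀ a, 0 ≤ F |a|)
    (hint : Integrable fun a => F |a|) : ∫ z : UnitAddCircle, F ‖z‖ ≤ ∫ a, F |a| := by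
  rw [← UnitAddCircle.integral_preimage (-(1 / 2))]
  refine le_trans (le_of_eq (setIntegral_congr_fun measurableSet_Ioc fun a ha => ?_))
    (setIntegral_le_integral hint (Eventually.of_forall hF))
  have : |a| ≤ 1 / 2 := abs_le.2 ⟨ha.1.le, by linarith [ha.2]⟩
  simp only [(AddCircle.norm_coe_eq_abs_iff 1 (x := a) one_ne_zero).2 (by simpa using this)]

theorem integrable_of_continuous_unitAddCircle {E : Type*} [NormedAddCommGroup E]
    {F : UnitAddCircle → E} (hF : Continuous F) : Integrable F :=
  hF.integrable_of_hasCompactSupport (HasCompactSupport.of_compactSpace F)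

theorem norm_le_one_unitAddCircle (z : UnitAddCircle) : ‖z‖ ≤ 1 := by
  have := AddCircle.norm_le_half_period 1 (x := z) one_ne_zero
  rw [abs_one] at this
  linarith

theorem IsKernelSymbol.integral_norm_kernel_mul_le_of_le_one {C r s : ℝ} {m : ℤ → ℂ}
    (h : IsKernelSymbol C r m) (hr : r ≤ 1) (h0 : 0 ≤ s) (h1 : s < 1) :
    ∫ z : UnitAddCircle, ‖kernel m z‖ * ‖z‖ ^ s
      ≤ 3 * (∫ w : ℝ, |w| ^ s * (1 + |w| ^ 2)⁻¹) * C * r ^ s := by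
  have hr0 := h.pos
  have hC := h.nonneg
  let F : ℝ → ℝ := fun t => 3 * C * r ^ (s - 1) * ((t / r) ^ s * (1 + (t / r) ^ 2)⁻¹)
  have F_abs : ∀ a, F |a| = 3 * C * r ^ (s - 1) * (|a / r| ^ s * (1 + |a / r| ^ 2)⁻¹) := fun a => by
    simp only [F, abs_div, abs_of_pos hr0]
  have continuous_F : Continuous fun z : UnitAddCircle => F ‖z‖ := by
    refine continuous_const.mul (((continuous_norm.div_const r).rpow_const fun _ => .inr h0).mul ?_)
    exact Continuous.inv₀ (by fun_prop) fun z => by positivity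
  calc ∫ z : UnitAddCircle, ‖kernel m z‖ * ‖z‖ ^ s
      ≤ ∫ z : UnitAddCircle, F ‖z‖ := by
        refine integral_mono (integrable_of_continuous_unitAddCircle
          (h.continuous_kernel.norm.mul (continuous_norm.rpow_const fun _ => .inr h0)))
          (integrable_of_continuous_unitAddCircle continuous_F) fun z => ?_
        refine (mul_le_mul_of_nonneg_right (h.norm_kernel_le_of_le_one hr z)
          (by positivity)).trans (le_of_eq ?_)
        simp only [F]
        rw [Real.div_rpow (norm_nonneg _) hr0.le, Real.rpow_sub hr0, Real.rpow_one]
        field_simp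
    _ ≤ ∫ a : ℝ, F |a| := by
        refine integral_comp_norm_le (fun a => by simp only [F]; positivity) ?_
        simp only [F_abs]
        exact ((integrable_abs_rpow_mul_inv h0 h1).comp_div hr0.ne').const_mul _
    _ = 3 * C * r ^ (s - 1) * (r * ∫ w : ℝ, |w| ^ s * (1 + |w| ^ 2)⁻¹) := by
        simp only [F_abs]
        rw [integral_const_mul, Measure.integral_comp_div (fun w : ℝ => |w| ^ s * (1 + |w| ^ 2)⁻¹),
          abs_of_pos hr0, smul_eq_mul]
    _ = _ := by rw [Real.rpow_sub hr0, Real.rpow_one]; field_simp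

theorem IsKernelSymbol.integral_norm_kernel_mul_le_of_one_le {C r s : ℝ} {m : ℤ → ℂ}
    (h : IsKernelSymbol C r m) (hr : 1 ≤ r) (h0 : 0 ≤ s) :
    ∫ z : UnitAddCircle, ‖kernel m z‖ * ‖z‖ ^ s ≤ 2 * C * r ^ s := by
  have norm_kernel_le : ∀ z, ‖kernel m z‖ ≤ 2 * C := fun z =>
    (h.norm_kernel_le z).trans (by nlinarith [h.nonneg, inv_le_one_of_one_le₀ hr])
  calc ∫ z : UnitAddCircle, ‖kernel m z‖ * ‖z‖ ^ s
      ≤ ∫ _ : UnitAddCircle, 2 * C * r ^ s := by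
        refine integral_mono (integrable_of_continuous_unitAddCircle
          (h.continuous_kernel.norm.mul (continuous_norm.rpow_const fun _ => .inr h0)))
          (integrable_const _) fun z => ?_
        have := h.nonneg
        exact mul_le_mul (norm_kernel_le z) (Real.rpow_le_rpow (norm_nonneg z)
          ((norm_le_one_unitAddCircle z).trans hr) h0) (by positivity) (by positivity)
    _ = 2 * C * r ^ s := by simp [Measure.real]

theorem IsKernelSymbol.exists_integral_norm_kernel_mul_le {s : ℝ} (h0 : 0 ≤ s) (h1 : s < 1) :
    ∃ D, 0 ≤ D ∧ ∀ (C r : ℝ) (m : ℤ → ℂ), IsKernelSymbol C r m →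
      ∫ z : UnitAddCircle, ‖kernel m z‖ * ‖z‖ ^ s ≤ D * C * r ^ s := by
  have integral_nonneg : 0 ≤ ∫ w : ℝ, |w| ^ s * (1 + |w| ^ 2)⁻¹ :=
    integral_nonneg fun w => by positivity
  refine ⟨3 * (∫ w : ℝ, |w| ^ s * (1 + |w| ^ 2)⁻¹) + 2, by positivity, fun C r m h => ?_⟩
  have hC := h.nonneg
  have hr := h.pos
  rcases le_total r 1 with hr | hr
  · refine (h.integral_norm_kernel_mul_le_of_le_one hr h0 h1).trans ?_
    gcongr
    linarith
  · refine (h.integral_norm_kernel_mul_le_of_one_le hr h0).trans ?_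
    gcongr
    linarith

/-! ### Multipliers acting on Hölder functions -/

theorem integrableOn_cell_of_continuous {E : Type*} [NormedAddCommGroup E] {u : ℝ × ℝ → E}
    (hu : Continuous u) : IntegrableOn u cell :=
  (hu.continuousOn.integrableOn_compact (isCompact_Icc.prod isCompact_Icc :
    IsCompact (Set.Icc (0 : ℝ) 1 ×ˢ Set.Icc (0 : ℝ) 1))).mono_set
    (Set.prod_mono Set.Ico_subset_Icc_self Set.Ico_subset_Icc_self)

theorem integral_Ico_comp_sub (F : UnitAddCircle → ℝ) (a : ℝ) :
    ∫ y in Ico (0 : ℝ) 1, F ↑(a - y) = ∫ z, F z := by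
  calc ∫ y in Ico (0 : ℝ) 1, F ↑(a - y) = ∫ y in (0 : ℝ)..0 + 1, F (a - (y : UnitAddCircle)) := by
        rw [zero_add, intervalIntegral.integral_of_le zero_le_one, integral_Ico_eq_integral_Ioc]
        simp only [AddCircle.coe_sub]
    _ = ∫ z : UnitAddCircle, F (a - z) :=
        UnitAddCircle.intervalIntegral_preimage 0 fun z => F (a - z)
    _ = ∫ z, F z := integral_sub_left_eq_self F volume _

theorem integral_cell_comp_sub (F₁ F₂ : UnitAddCircle → ℝ) (x : ℝ × ℝ) :
    ∫ y in cell, F₁ ↑(x.1 - y.1) * F₂ ↑(x.2 - y.2) = (∫ z, F₁ z) * ∫ z, F₂ z := by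
  rw [cell, Measure.volume_eq_prod, ← integral_Ico_comp_sub F₁ x.1, ← integral_Ico_comp_sub F₂ x.2]
  exact setIntegral_prod_mul (fun y => F₁ ↑(x.1 - y)) (fun y => F₂ ↑(x.2 - y)) _ _

theorem continuous_mul_comp_sub {A : Type*} [TopologicalSpace A] [Mul A] [ContinuousMul A]
    {F₁ F₂ : UnitAddCircle → A} (h₁ : Continuous F₁) (h₂ : Continuous F₂) (x : ℝ × ℝ) :
    Continuous fun y : ℝ × ℝ => F₁ ↑(x.1 - y.1) * F₂ ↑(x.2 - y.2) := by
  have continuous_sub : ∀ a : ℝ, Continuous fun y : ℝ => ((a - y : ℝ) : UnitAddCircle) :=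
    fun a => (AddCircle.continuous_mk' 1).comp (continuous_const.sub continuous_id)
  exact (h₁.comp ((continuous_sub _).comp continuous_fst)).mul
    (h₂.comp ((continuous_sub _).comp continuous_snd))

theorem IsPeriodic.add_int {u : ℝ × ℝ → ℂ} (hu : IsPeriodic u) (x : ℝ × ℝ) (a b : ℤ) :
    u (x.1 + a, x.2 + b) = u x := by
  have periodic_fst : Function.Periodic (fun t => u (t, x.2 + b)) 1 := fun t => (hu (t, x.2 + b)).1
  have periodic_snd : Function.Periodic (fun t => u (x.1, t)) 1 := fun t => (hu (x.1, t)).2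
  have add_fst := periodic_fst.int_mul a x.1
  have add_snd := periodic_snd.int_mul b x.2
  simp only [mul_one] at add_fst add_snd
  rw [add_fst, add_snd]

theorem IsPeriodic.norm_sub_le {u : ℝ × ℝ → ℂ} (hu : IsPeriodic u) {G s : ℝ} (hG : 0 ≤ G)
    (h0 : 0 ≤ s) (h1 : s ≤ 1) (h : ∀ x y, ‖u y - u x‖ ≤ G * aDist y x ^ s) (x y : ℝ × ℝ) :
    ‖u y - u x‖ ≤ G * (‖((x.1 - y.1 : ℝ) : UnitAddCircle)‖ ^ s
      + ‖((x.2 - y.2 : ℝ) : UnitAddCircle)‖ ^ (2 / 3 * s)) := by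
  have := h x (y.1 + round (x.1 - y.1), y.2 + round (x.2 - y.2))
  rw [hu.add_int y] at this
  refine this.trans (mul_le_mul_of_nonneg_left ?_ hG)
  have abs_eq (a b : ℝ) : |b + round (a - b) - a| = ‖((a - b : ℝ) : UnitAddCircle)‖ := by
    rw [UnitAddCircle.norm_eq, abs_sub_comm]; congr 1; ring
  rw [aDist, abs_eq, abs_eq, Real.rpow_mul (norm_nonneg _)]
  exact Real.rpow_add_le_add_rpow (norm_nonneg _) (by positivity) h0 h1

theorem norm_coeff_toDistr_le (u : PerFun) (k : ℤ × ℤ) :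
    ‖u.toDistr.coeff k‖ ≤ ∫ x in cell, ‖u x‖ := by
  refine (norm_integral_le_integral_norm _).trans (le_of_eq ?_)
  simp only [norm_mul, TestFun.norm_expo, mul_one]

theorem coeff_const (c : ℂ) (k : ℤ × ℤ) :
    (PerFun.const c).toDistr.coeff k = if k = 0 then c else 0 := by
  change ∫ x in cell, c * TestFun.expo (-k) x = _
  have integral_expo := TestFun.fourier_expo k 0
  rw [TestFun.fourier_apply] at integral_expo
  have expo_zero : ∀ x, TestFun.expo (0 : ℤ × ℤ) x = 1 := fun x => by simp [TestFun.expo_apply]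
  simp only [expo_zero, mul_one] at integral_expo
  rw [integral_const_mul, integral_expo, mul_ite, mul_one, mul_zero]

theorem expo_eq_fourier_mul (k : ℤ × ℤ) (x : ℝ × ℝ) :
    TestFun.expo k x = fourier k.1 (x.1 : UnitAddCircle) * fourier k.2 (x.2 : UnitAddCircle) := by
  rw [TestFun.expo_apply, fourier_coe_apply, fourier_coe_apply, ← Complex.exp_add]
  congr 1; push_cast; ring

theorem expo_sub (k : ℤ × ℤ) (x y : ℝ × ℝ) :
    TestFun.expo k (x - y) = TestFun.expo k x * TestFun.expo (-k) y := by
  rw [TestFun.expo_apply, TestFun.expo_apply, TestFun.expo_apply, ← Complex.exp_add]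
  congr 1
  simp only [Prod.fst_sub, Prod.snd_sub, Prod.fst_neg, Prod.snd_neg]
  push_cast; ring

section kernel

variable {C₁ C₂ r₁ r₂ : ℝ} {m₁ m₂ : ℤ → ℂ}

theorem kernel_mul_kernel (h₁ : IsKernelSymbol C₁ r₁ m₁) (h₂ : IsKernelSymbol C₂ r₂ m₂)
    (x : ℝ × ℝ) :
    kernel m₁ x.1 * kernel m₂ x.2 = ∑' k : ℤ × ℤ, m₁ k.1 * m₂ k.2 * TestFun.expo k x := by
  have summable : ∀ {C r} {m : ℤ → ℂ}, IsKernelSymbol C r m → ∀ z : UnitAddCircle,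
      Summable fun n => ‖m n * fourier n z‖ := fun h z => by
    simpa only [norm_mul, norm_fourier_apply, mul_one] using h.summable_norm
  rw [kernel, kernel, tsum_mul_tsum_of_summable_norm (summable h₁ _) (summable h₂ _)]
  refine tsum_congr fun k => ?_
  rw [expo_eq_fourier_mul]
  ring

theorem tsum_coeff_eq_integral (u : PerFun) (h₁ : IsKernelSymbol C₁ r₁ m₁)
    (h₂ : IsKernelSymbol C₂ r₂ m₂) (x : ℝ × ℝ) :
    ∑' k : ℤ × ℤ, m₁ k.1 * m₂ k.2 * u.toDistr.coeff k * TestFun.expo k x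
      = ∫ y in cell, u y * (kernel m₁ ↑(x.1 - y.1) * kernel m₂ ↑(x.2 - y.2)) := by
  have summable_norm : Summable fun k : ℤ × ℤ => ‖m₁ k.1‖ * ‖m₂ k.2‖ :=
    h₁.summable_norm.mul_of_nonneg h₂.summable_norm (fun _ => norm_nonneg _) fun _ => norm_nonneg _
  let F : ℤ × ℤ → ℝ × ℝ → ℂ := fun k y =>
    m₁ k.1 * m₂ k.2 * TestFun.expo k x * (u y * TestFun.expo (-k) y)
  have integral_F : ∀ k, ∫ y in cell, F k y
      = m₁ k.1 * m₂ k.2 * u.toDistr.coeff k * TestFun.expo k x := fun k => by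
    simp only [F, integral_const_mul]
    change _ * (u.toDistr.coeff k) = _
    ring
  have tsum_F : ∀ y, ∑' k, F k y
      = u y * (kernel m₁ ↑(x.1 - y.1) * kernel m₂ ↑(x.2 - y.2)) := fun y => by
    rw [← Prod.fst_sub, ← Prod.snd_sub, kernel_mul_kernel h₁ h₂, ← tsum_mul_left]
    refine tsum_congr fun k => ?_
    rw [expo_sub]
    ring
  have hasSum_integral_F := hasSum_integral_of_summable_integral_norm (F := F)
    (fun k => (TestFun.integrableOn_mul u.integrable _).const_mul _) (by
      simp only [F, norm_mul, TestFun.norm_expo, mul_one, integral_const_mul]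
      exact summable_norm.mul_right _)
  simp only [integral_F, tsum_F] at hasSum_integral_F
  exact hasSum_integral_F.tsum_eq

theorem integral_kernel_mul_kernel (h₁ : IsKernelSymbol C₁ r₁ m₁) (h₂ : IsKernelSymbol C₂ r₂ m₂)
    (x : ℝ × ℝ) (c : ℂ) :
    ∫ y in cell, c * (kernel m₁ ↑(x.1 - y.1) * kernel m₂ ↑(x.2 - y.2)) = c * (m₁ 0 * m₂ 0) := by
  refine (tsum_coeff_eq_integral (PerFun.const c) h₁ h₂ x).symm.trans ?_
  rw [tsum_eq_single 0 fun k hk => by simp [coeff_const, hk]]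
  simp [coeff_const, TestFun.expo_apply, mul_comm]

theorem tsum_coeff_eq_integral_sub (u : PerFun) (h₁ : IsKernelSymbol C₁ r₁ m₁)
    (h₂ : IsKernelSymbol C₂ r₂ m₂) (hm : m₁ 0 = 0) (x : ℝ × ℝ) :
    ∑' k : ℤ × ℤ, m₁ k.1 * m₂ k.2 * u.toDistr.coeff k * TestFun.expo k x
      = ∫ y in cell, (u y - u x) * (kernel m₁ ↑(x.1 - y.1) * kernel m₂ ↑(x.2 - y.2)) := by
  have integrable_kernel : ∀ v : PerFun, IntegrableOn
      (fun y => v y * (kernel m₁ ↑(x.1 - y.1) * kernel m₂ ↑(x.2 - y.2))) cell := fun v => by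
    refine v.integrable.mul_bdd (c := C₁ * (1 + r₁⁻¹) * (C₂ * (1 + r₂⁻¹)))
      (continuous_mul_comp_sub h₁.continuous_kernel h₂.continuous_kernel x).aestronglyMeasurable
      (.of_forall fun y => ?_)
    rw [norm_mul]
    exact mul_le_mul (h₁.norm_kernel_le _) (h₂.norm_kernel_le _) (norm_nonneg _)
      ((norm_nonneg _).trans (h₁.norm_kernel_le 0))
  simp only [sub_mul]
  rw [tsum_coeff_eq_integral u h₁ h₂]
  refine Eq.trans ?_ (integral_sub (integrable_kernel u)
    (integrable_kernel (PerFun.const (u x)))).symm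
  have integral_const : ∫ y in cell, PerFun.const (u x) y
      * (kernel m₁ ↑(x.1 - y.1) * kernel m₂ ↑(x.2 - y.2)) = 0 := by
    refine (integral_kernel_mul_kernel h₁ h₂ x (u x)).trans ?_
    rw [hm, zero_mul, mul_zero]
  rw [integral_const, sub_zero]

theorem norm_tsum_coeff_le (u : PerFun) {G s : ℝ} (hG : 0 ≤ G) (h0 : 0 ≤ s) (h1 : s ≤ 1)
    (hu : ∀ x y, ‖u y - u x‖ ≤ G * aDist y x ^ s) (h₁ : IsKernelSymbol C₁ r₁ m₁)
    (h₂ : IsKernelSymbol C₂ r₂ m₂) (hm : m₁ 0 = 0) (x : ℝ × ℝ) :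
    ‖∑' k : ℤ × ℤ, m₁ k.1 * m₂ k.2 * u.toDistr.coeff k * TestFun.expo k x‖
      ≤ G * ((∫ z, ‖kernel m₁ z‖ * ‖z‖ ^ s) * (∫ z, ‖kernel m₂ z‖)
        + (∫ z, ‖kernel m₁ z‖) * ∫ z, ‖kernel m₂ z‖ * ‖z‖ ^ (2 / 3 * s)) := by
  let F₁ : UnitAddCircle → ℝ := fun z => ‖kernel m₁ z‖ * ‖z‖ ^ s
  let F₂ : UnitAddCircle → ℝ := fun z => ‖kernel m₂ z‖ * ‖z‖ ^ (2 / 3 * s)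
  have integrable₁ := integrableOn_cell_of_continuous (continuous_mul_comp_sub
    (F₁ := F₁) (F₂ := fun z => ‖kernel m₂ z‖)
    (h₁.continuous_kernel.norm.mul (continuous_norm.rpow_const fun _ => .inr h0))
    h₂.continuous_kernel.norm x)
  have integrable₂ := integrableOn_cell_of_continuous (continuous_mul_comp_sub
    (F₁ := fun z => ‖kernel m₁ z‖) (F₂ := F₂)
    h₁.continuous_kernel.norm
    (h₂.continuous_kernel.norm.mul (continuous_norm.rpow_const fun _ => .inr (by positivity))) x)
  rw [tsum_coeff_eq_integral_sub u h₁ h₂ hm]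
  calc ‖∫ y in cell, (u y - u x) * (kernel m₁ ↑(x.1 - y.1) * kernel m₂ ↑(x.2 - y.2))‖
      ≤ ∫ y in cell, G * (F₁ ↑(x.1 - y.1) * ‖kernel m₂ ↑(x.2 - y.2)‖
          + ‖kernel m₁ ↑(x.1 - y.1)‖ * F₂ ↑(x.2 - y.2)) := by
        refine norm_integral_le_of_norm_le ((integrable₁.add integrable₂).const_mul G)
          (.of_forall fun y => ?_)
        rw [norm_mul, norm_mul]
        refine (mul_le_mul_of_nonneg_right (u.periodic.norm_sub_le hG h0 h1 hu x y)
          (by positivity)).trans (le_of_eq ?_)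
        simp only [F₁, F₂]
        ring
    _ = _ := by
        rw [integral_const_mul, integral_add integrable₁ integrable₂,
          integral_cell_comp_sub F₁ fun z => ‖kernel m₂ z‖,
          integral_cell_comp_sub (fun z => ‖kernel m₁ z‖) F₂]

end kernel

theorem exists_norm_tsum_coeff_le {s : ℝ} (h0 : 0 ≤ s) (h1 : s < 1) :
    ∃ D, 0 ≤ D ∧ ∀ (u : PerFun) (G C₁ C₂ r₁ r₂ : ℝ) (m₁ m₂ : ℤ → ℂ), 0 ≤ G →
      (∀ x y, ‖u y - u x‖ ≤ G * aDist y x ^ s) →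
      IsKernelSymbol C₁ r₁ m₁ → IsKernelSymbol C₂ r₂ m₂ → m₁ 0 = 0 → ∀ x,
      ‖∑' k : ℤ × ℤ, m₁ k.1 * m₂ k.2 * u.toDistr.coeff k * TestFun.expo k x‖
        ≤ D * (C₁ * C₂) * (r₁ ^ s + r₂ ^ (2 / 3 * s)) * G := by
  obtain ⟨D₀, hD₀, mass_le⟩ := IsKernelSymbol.exists_integral_norm_kernel_mul_le le_rfl one_pos
  obtain ⟨D₁, hD₁, moment_le⟩ := IsKernelSymbol.exists_integral_norm_kernel_mul_le h0 h1
  obtain ⟨D₂, hD₂, moment_le'⟩ := IsKernelSymbol.exists_integral_norm_kernel_mul_le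
    (s := 2 / 3 * s) (by linarith) (by linarith)
  simp only [Real.rpow_zero, mul_one] at mass_le
  refine ⟨D₀ * (D₁ + D₂), by positivity, fun u G C₁ C₂ r₁ r₂ m₁ m₂ hG hu h₁ h₂ hm x => ?_⟩
  have hC₁ := h₁.nonneg
  have hC₂ := h₂.nonneg
  have hr₁ := h₁.pos
  have hr₂ := h₂.pos
  calc ‖∑' k : ℤ × ℤ, m₁ k.1 * m₂ k.2 * u.toDistr.coeff k * TestFun.expo k x‖
      ≤ G * ((∫ z, ‖kernel m₁ z‖ * ‖z‖ ^ s) * (∫ z, ‖kernel m₂ z‖)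
        + (∫ z, ‖kernel m₁ z‖) * ∫ z, ‖kernel m₂ z‖ * ‖z‖ ^ (2 / 3 * s)) :=
        norm_tsum_coeff_le u hG h0 h1.le hu h₁ h₂ hm x
    _ ≤ G * (D₁ * C₁ * r₁ ^ s * (D₀ * C₂) + D₀ * C₁ * (D₂ * C₂ * r₂ ^ (2 / 3 * s))) := by
        gcongr
        exacts [moment_le _ _ _ h₁, mass_le _ _ _ h₂, mass_le _ _ _ h₁, moment_le' _ _ _ h₂]
    _ = D₀ * (C₁ * C₂) * (D₁ * r₁ ^ s + D₂ * r₂ ^ (2 / 3 * s)) * G := by ring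
    _ ≤ D₀ * (C₁ * C₂) * ((D₁ + D₂) * r₁ ^ s + (D₁ + D₂) * r₂ ^ (2 / 3 * s)) * G := by
        gcongr <;> linarith
    _ = D₀ * (D₁ + D₂) * (C₁ * C₂) * (r₁ ^ s + r₂ ^ (2 / 3 * s)) * G := by ring

theorem continuous_tsum_mul_expo {c : ℤ × ℤ → ℂ} (hc : Summable fun k => ‖c k‖) :
    Continuous fun x => ∑' k, c k * TestFun.expo k x :=
  continuous_tsum (fun k => continuous_const.mul (TestFun.expo k).continuous) hc fun k x => by
    rw [norm_mul, TestFun.norm_expo, mul_one]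

theorem integral_tsum_mul_expo {c : ℤ × ℤ → ℂ} (hc : Summable fun k => ‖c k‖) (k : ℤ × ℤ) :
    ∫ x in cell, (∑' l, c l * TestFun.expo l x) * TestFun.expo (-k) x = c k := by
  let F : ℤ × ℤ → ℝ × ℝ → ℂ := fun l x => c l * (TestFun.expo (-k) x * TestFun.expo l x)
  have integral_F (l : ℤ × ℤ) : ∫ x in cell, F l x = c l * if k = l then 1 else 0 := by
    rw [integral_const_mul, ← TestFun.fourier_expo, TestFun.fourier_apply]
  have tsum_F (x : ℝ × ℝ) :
      ∑' l, F l x = (∑' l, c l * TestFun.expo l x) * TestFun.expo (-k) x := by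
    rw [← tsum_mul_right]
    exact tsum_congr fun l => by ring
  have hasSum_integral_F := hasSum_integral_of_summable_integral_norm (F := F)
    (fun l => (TestFun.integrableOn_mul (TestFun.expo (-k)).integrableOn _).const_mul _)
    (hc.congr fun l => by
      simp only [F, norm_mul, TestFun.norm_expo, mul_one]
      simp [Measure.real, TestFun.volume_cell])
  simp only [integral_F, tsum_F] at hasSum_integral_F
  rw [← hasSum_integral_F.tsum_eq,
    tsum_eq_single k fun l hl => by rw [if_neg hl.symm, mul_zero], if_pos rfl, mul_one]

/-! ### The semigroup `exp(-t(|∂₁|³ - ∂₂²))` -/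

/-- The symbol of `|∂₁|³ - ∂₂² = |∂₁| ℒ`, where `k` counts multiples of `2π`. -/
def heatSymbol (k : ℤ × ℤ) : ℝ := (2 * Real.pi * |(k.1 : ℝ)|) ^ 3 + (2 * Real.pi * k.2) ^ 2

theorem heatSymbol_nonneg (k : ℤ × ℤ) : 0 ≤ heatSymbol k := by
  have := Real.pi_pos
  unfold heatSymbol
  positivity

theorem heatSymbol_pos {k : ℤ × ℤ} (hk : k ≠ 0) : 0 < heatSymbol k := by
  have := Real.pi_pos
  unfold heatSymbol
  by_cases h : k.1 = 0
  · have hsnd : (k.2 : ℝ) ≠ 0 := fun hsnd => hk (Prod.ext h (by exact_mod_cast hsnd))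
    exact add_pos_of_nonneg_of_pos (by positivity) (by positivity)
  · have : (k.1 : ℝ) ≠ 0 := by exact_mod_cast h
    positivity

theorem abs_add_abs_le_heatSymbol (k : ℤ × ℤ) : |(k.1 : ℝ)| + |(k.2 : ℝ)| ≤ heatSymbol k := by
  have abs_le_pow (n : ℤ) {p : ℕ} (hp : p ≠ 0) : |(n : ℝ)| ≤ (2 * Real.pi * |(n : ℝ)|) ^ p := by
    rcases eq_or_ne n 0 with rfl | hn
    · simp [hp]
    · have one_le : (1 : ℝ) ≤ |(n : ℝ)| := by exact_mod_cast Int.one_le_abs hn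
      have le_mul : |(n : ℝ)| ≤ 2 * Real.pi * |(n : ℝ)| := by nlinarith [Real.pi_gt_three]
      exact le_mul.trans (le_self_pow₀ (one_le.trans le_mul) hp)
  have abs_snd_le := abs_le_pow k.2 two_ne_zero
  rw [mul_pow, sq_abs, ← mul_pow] at abs_snd_le
  exact add_le_add (abs_le_pow k.1 three_ne_zero) abs_snd_le

theorem exists_exp_neg_mul_mul_pow_le {t : ℝ} (ht : 0 < t) (N : ℕ) :
    ∃ D, 0 ≤ D ∧ ∀ y, 0 ≤ y → Real.exp (-(t * y)) * (1 + y) ^ N ≤ D * (1 / (1 + y) ^ 2) := by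
  refine ⟨(N + 2).factorial / t ^ (N + 2) * Real.exp t, by positivity, fun y hy => ?_⟩
  have pow_le := Real.pow_div_factorial_le_exp (t * (1 + y)) (by positivity) (N + 2)
  have exp_split : Real.exp (t * (1 + y)) * Real.exp (-(t * y)) = Real.exp t := by
    rw [← Real.exp_add]; congr 1; ring
  rw [mul_one_div, le_div_iff₀ (by positivity), mul_assoc, ← pow_add, div_mul_eq_mul_div,
    le_div_iff₀ (by positivity)]
  rw [div_le_iff₀ (by positivity), mul_pow] at pow_le
  calc Real.exp (-(t * y)) * (1 + y) ^ (N + 2) * t ^ (N + 2)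
      = t ^ (N + 2) * (1 + y) ^ (N + 2) * Real.exp (-(t * y)) := by ring
    _ ≤ Real.exp (t * (1 + y)) * ((N + 2).factorial : ℝ) * Real.exp (-(t * y)) := by gcongr
    _ = (N + 2).factorial * Real.exp t := by rw [← exp_split]; ring

theorem norm_two_pi_I_mul_int (n : ℤ) :
    ‖2 * Real.pi * Complex.I * (n : ℂ)‖ = 2 * Real.pi * |(n : ℝ)| := by
  simp [abs_of_pos Real.pi_pos]

/-- Polynomial growth of a family of Fourier coefficients, as that of the coefficients of a
periodic distribution. -/
def PolyGrowth (c : ℤ × ℤ → ℂ) : Prop :=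
  ∃ (K : ℝ) (N : ℕ), 0 ≤ K ∧ ∀ k, ‖c k‖ ≤ K * ((1 + |(k.1 : ℝ)|) ^ N * (1 + |(k.2 : ℝ)|) ^ N)

namespace PolyGrowth

variable {c m : ℤ × ℤ → ℂ}

theorem of_norm_le (hc : PolyGrowth c) (h : ∀ k, ‖m k‖ ≤ ‖c k‖) : PolyGrowth m := by
  obtain ⟨K, N, hK, hc⟩ := hc
  exact ⟨K, N, hK, fun k => (h k).trans (hc k)⟩

theorem of_bounded {C : ℝ} (h : ∀ k, ‖c k‖ ≤ C) : PolyGrowth c :=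
  ⟨C, 0, (norm_nonneg _).trans (h 0), fun k => by simpa using h k⟩

theorem mul (hm : PolyGrowth m) (hc : PolyGrowth c) : PolyGrowth fun k => m k * c k := by
  obtain ⟨K, N, hK, h⟩ := hm
  obtain ⟨L, M, hL, h'⟩ := hc
  refine ⟨K * L, N + M, by positivity, fun k => ?_⟩
  rw [norm_mul]
  exact (mul_le_mul (h k) (h' k) (norm_nonneg _) (by positivity)).trans (le_of_eq (by ring))

theorem pow (hm : PolyGrowth m) (n : ℕ) : PolyGrowth fun k => m k ^ n := by
  induction n with
  | zero => exact .of_bounded (C := 1) fun k => by simp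
  | succ n ih => simpa only [pow_succ] using ih.mul hm

theorem add (hm : PolyGrowth m) (hc : PolyGrowth c) : PolyGrowth fun k => m k + c k := by
  obtain ⟨K, N, hK, h⟩ := hm
  obtain ⟨L, M, hL, h'⟩ := hc
  refine ⟨K + L, N + M, by positivity, fun k => (norm_add_le _ _).trans ?_⟩
  have pow_le {i j : ℕ} (hij : i ≤ j) (n : ℤ) : (1 + |(n : ℝ)|) ^ i ≤ (1 + |(n : ℝ)|) ^ j :=
    pow_le_pow_right₀ (by linarith [abs_nonneg (n : ℝ)]) hij
  rw [add_mul]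
  refine add_le_add ((h k).trans ?_) ((h' k).trans ?_)
  · gcongr ?_ * (?_ * ?_) <;> exact pow_le (by omega) _
  · gcongr ?_ * (?_ * ?_) <;> exact pow_le (by omega) _

theorem fst : PolyGrowth fun k => 2 * Real.pi * Complex.I * (k.1 : ℂ) := by
  refine ⟨2 * Real.pi, 1, by positivity, fun k => ?_⟩
  rw [norm_two_pi_I_mul_int, pow_one, pow_one]
  gcongr
  nlinarith [abs_nonneg (k.1 : ℝ), abs_nonneg (k.2 : ℝ)]

theorem snd : PolyGrowth fun k => 2 * Real.pi * Complex.I * (k.2 : ℂ) := by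
  refine ⟨2 * Real.pi, 1, by positivity, fun k => ?_⟩
  rw [norm_two_pi_I_mul_int, pow_one, pow_one]
  gcongr
  nlinarith [abs_nonneg (k.1 : ℝ), abs_nonneg (k.2 : ℝ)]

theorem heatSymbol : PolyGrowth fun k => (heatSymbol k : ℂ) := by
  have hfst : PolyGrowth fun k => (((2 * Real.pi * |(k.1 : ℝ)|) ^ 3 : ℝ) : ℂ) :=
    (fst.pow 3).of_norm_le fun k => by
      rw [norm_pow, norm_two_pi_I_mul_int, Complex.norm_of_nonneg (by positivity)]
  have hsnd : PolyGrowth fun k => (((2 * Real.pi * (k.2 : ℝ)) ^ 2 : ℝ) : ℂ) :=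
    (snd.pow 2).of_norm_le fun k => by
      rw [norm_pow, norm_two_pi_I_mul_int, Complex.norm_of_nonneg (by positivity),
        mul_pow _ |(k.2 : ℝ)|, sq_abs, ← mul_pow]
  simpa only [AnisoTorus.heatSymbol, Complex.ofReal_add] using hfst.add hsnd

theorem summable (hc : PolyGrowth c) {t : ℝ} (ht : 0 < t) :
    Summable fun k => Real.exp (-(t * AnisoTorus.heatSymbol k)) * ‖c k‖ := by
  obtain ⟨K, N, hK, h⟩ := hc
  obtain ⟨D, hD, exp_le⟩ := exists_exp_neg_mul_mul_pow_le ht N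
  refine Summable.of_nonneg_of_le (fun k => by positivity) (fun k => ?_)
    (PerDistr.summable_weight.mul_left (K * (D * D)))
  have exp_heatSymbol_le : Real.exp (-(t * AnisoTorus.heatSymbol k))
      ≤ Real.exp (-(t * |(k.1 : ℝ)|)) * Real.exp (-(t * |(k.2 : ℝ)|)) := by
    rw [← Real.exp_add, Real.exp_le_exp]
    nlinarith [abs_add_abs_le_heatSymbol k]
  calc Real.exp (-(t * AnisoTorus.heatSymbol k)) * ‖c k‖
      ≤ (Real.exp (-(t * |(k.1 : ℝ)|)) * Real.exp (-(t * |(k.2 : ℝ)|)))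
        * (K * ((1 + |(k.1 : ℝ)|) ^ N * (1 + |(k.2 : ℝ)|) ^ N)) := by
        gcongr
        exact h k
    _ = K * ((Real.exp (-(t * |(k.1 : ℝ)|)) * (1 + |(k.1 : ℝ)|) ^ N)
        * (Real.exp (-(t * |(k.2 : ℝ)|)) * (1 + |(k.2 : ℝ)|) ^ N)) := by ring
    _ ≤ K * ((D * (1 / (1 + |(k.1 : ℝ)|) ^ 2)) * (D * (1 / (1 + |(k.2 : ℝ)|) ^ 2))) := by
        gcongr K * (?_ * ?_) <;> exact exp_le _ (abs_nonneg _)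
    _ = K * (D * D) * PerDistr.weight k := by rw [PerDistr.weight]; ring

end PolyGrowth

/-- The Fourier coefficients of `∂₁ⁱ ∂₂ʲ f`, if `f` has the coefficients `c`. -/
def derivCoeff (i j : ℕ) (c : ℤ × ℤ → ℂ) (k : ℤ × ℤ) : ℂ :=
  (2 * Real.pi * Complex.I * k.1) ^ i * (2 * Real.pi * Complex.I * k.2) ^ j * c k

theorem PolyGrowth.derivCoeff {c : ℤ × ℤ → ℂ} (hc : PolyGrowth c) (i j : ℕ) :
    PolyGrowth (derivCoeff i j c) :=
  ((PolyGrowth.fst.pow i).mul (PolyGrowth.snd.pow j)).mul hc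

theorem derivCoeff_zero_zero (c : ℤ × ℤ → ℂ) : derivCoeff 0 0 c = c := by
  funext k; simp [derivCoeff]

/-- The semigroup `exp(-t(|∂₁|³ - ∂₂²))`, applied to the distribution with Fourier
coefficients `c`. -/
def heat (t : ℝ) (c : ℤ × ℤ → ℂ) (x : ℝ × ℝ) : ℂ :=
  ∑' k, (Real.exp (-(t * heatSymbol k)) : ℂ) * c k * TestFun.expo k x

theorem norm_exp_mul (t : ℝ) (c : ℤ × ℤ → ℂ) (k : ℤ × ℤ) :
    ‖(Real.exp (-(t * heatSymbol k)) : ℂ) * c k‖ = Real.exp (-(t * heatSymbol k)) * ‖c k‖ := by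
  rw [norm_mul, Complex.norm_of_nonneg (Real.exp_pos _).le]

theorem norm_heat_term (t : ℝ) (c : ℤ × ℤ → ℂ) (x : ℝ × ℝ) (k : ℤ × ℤ) :
    ‖(Real.exp (-(t * heatSymbol k)) : ℂ) * c k * TestFun.expo k x‖
      = Real.exp (-(t * heatSymbol k)) * ‖c k‖ := by
  rw [norm_mul, norm_exp_mul, TestFun.norm_expo, mul_one]

theorem heat_periodic (t : ℝ) (c : ℤ × ℤ → ℂ) : IsPeriodic (heat t c) := fun x => by
  simp only [heat, ((TestFun.expo _).periodic x).1, ((TestFun.expo _).periodic x).2, and_self]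

theorem hasDerivAt_expo_fst (k : ℤ × ℤ) (a b : ℝ) : HasDerivAt (fun s => TestFun.expo k (s, b))
    (2 * Real.pi * Complex.I * k.1 * TestFun.expo k (a, b)) a := by
  have hasFDerivAt_expo := ((TestFun.expo k).differentiable (a, b)).hasFDerivAt
  have hasDerivAt_line : HasDerivAt (fun s : ℝ => (s, b)) ((1 : ℝ), (0 : ℝ)) a :=
    (hasDerivAt_id a).prodMk (hasDerivAt_const a b)
  refine (hasFDerivAt_expo.comp_hasDerivAt a hasDerivAt_line).congr_deriv ?_
  change TestFun.d1 (TestFun.expo k) (a, b) = _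
  rw [TestFun.d1_expo, TestFun.smul_apply]

theorem hasDerivAt_expo_snd (k : ℤ × ℤ) (a b : ℝ) : HasDerivAt (fun s => TestFun.expo k (a, s))
    (2 * Real.pi * Complex.I * k.2 * TestFun.expo k (a, b)) b := by
  have hasFDerivAt_expo := ((TestFun.expo k).differentiable (a, b)).hasFDerivAt
  have hasDerivAt_line : HasDerivAt (fun s : ℝ => (a, s)) ((0 : ℝ), (1 : ℝ)) b :=
    (hasDerivAt_const b a).prodMk (hasDerivAt_id b)
  refine (hasFDerivAt_expo.comp_hasDerivAt b hasDerivAt_line).congr_deriv ?_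
  change TestFun.d2 (TestFun.expo k) (a, b) = _
  rw [TestFun.d2_expo, TestFun.smul_apply]

section heat

variable {c : ℤ × ℤ → ℂ} {t : ℝ}

theorem PolyGrowth.summable_norm_exp_mul (hc : PolyGrowth c) (ht : 0 < t) :
    Summable fun k => ‖(Real.exp (-(t * AnisoTorus.heatSymbol k)) : ℂ) * c k‖ := by
  simpa only [norm_exp_mul] using hc.summable ht

theorem summable_heat (hc : PolyGrowth c) (ht : 0 < t) (x : ℝ × ℝ) :
    Summable fun k => (Real.exp (-(t * heatSymbol k)) : ℂ) * c k * TestFun.expo k x :=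
  .of_norm (by simpa only [norm_heat_term] using hc.summable ht)

theorem heat_add {c' : ℤ × ℤ → ℂ} (hc : PolyGrowth c) (hc' : PolyGrowth c') (ht : 0 < t)
    (x : ℝ × ℝ) : heat t (fun k => c k + c' k) x = heat t c x + heat t c' x := by
  rw [heat, heat, heat, ← (summable_heat hc ht x).tsum_add (summable_heat hc' ht x)]
  exact tsum_congr fun k => by ring

theorem continuous_heat (hc : PolyGrowth c) (ht : 0 < t) : Continuous (heat t c) :=
  continuous_tsum_mul_expo (hc.summable_norm_exp_mul ht)

theorem integral_heat_mul_expo (hc : PolyGrowth c) (ht : 0 < t) (k : ℤ × ℤ) :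
    ∫ x in cell, heat t c x * TestFun.expo (-k) x = Real.exp (-(t * heatSymbol k)) * c k :=
  integral_tsum_mul_expo (hc.summable_norm_exp_mul ht) k

theorem hasDerivAt_heat_fst (hc : PolyGrowth c) (ht : 0 < t) (i j : ℕ) (a b : ℝ) :
    HasDerivAt (fun s => heat t (derivCoeff i j c) (s, b))
      (heat t (derivCoeff (i + 1) j c) (a, b)) a := by
  refine hasDerivAt_tsum ((hc.derivCoeff (i + 1) j).summable ht) (fun k s => ?_)
    (fun k s => (norm_heat_term t (derivCoeff (i + 1) j c) (s, b) k).le)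
    (summable_heat (hc.derivCoeff i j) ht (a, b)) a
  refine ((hasDerivAt_expo_fst k s b).const_mul _).congr_deriv ?_
  simp only [derivCoeff]
  ring

theorem hasDerivAt_heat_snd (hc : PolyGrowth c) (ht : 0 < t) (i j : ℕ) (a b : ℝ) :
    HasDerivAt (fun s => heat t (derivCoeff i j c) (a, s))
      (heat t (derivCoeff i (j + 1) c) (a, b)) b := by
  refine hasDerivAt_tsum ((hc.derivCoeff i (j + 1)).summable ht) (fun k s => ?_)
    (fun k s => (norm_heat_term t (derivCoeff i (j + 1) c) (a, s) k).le)
    (summable_heat (hc.derivCoeff i j) ht (a, b)) b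
  refine ((hasDerivAt_expo_snd k a s).const_mul _).congr_deriv ?_
  simp only [derivCoeff]
  ring

theorem hasDerivAt_heat_time (hc : PolyGrowth c) (ht : 0 < t) (x : ℝ × ℝ) :
    HasDerivAt (fun s => heat s c x) (-heat t (fun k => heatSymbol k * c k) x) t := by
  have hasDerivAt := hasDerivAt_tsum_of_isPreconnected (t := Set.Ioi (t / 2)) (y₀ := t) (y := t)
    (g := fun k s => (Real.exp (-(s * heatSymbol k)) : ℂ) * c k * TestFun.expo k x)
    (g' := fun k s => -((Real.exp (-(s * heatSymbol k)) : ℂ)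
      * (heatSymbol k * c k) * TestFun.expo k x))
    ((PolyGrowth.heatSymbol.mul hc).summable (half_pos ht)) isOpen_Ioi isPreconnected_Ioi
    (fun k s _ => ?_) (fun k s hs => ?_) (half_lt_self ht) (summable_heat hc ht x) (half_lt_self ht)
  · rwa [tsum_neg] at hasDerivAt
  · have hasDerivAt_exp : HasDerivAt (fun s : ℝ => Real.exp (-(s * heatSymbol k)))
        (Real.exp (-(s * heatSymbol k)) * -(1 * heatSymbol k)) s :=
      ((hasDerivAt_id s).mul_const (heatSymbol k)).neg.exp
    refine ((hasDerivAt_exp.ofReal_comp.mul_const (c k)).mul_const _).congr_deriv ?_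
    push_cast; ring
  · rw [norm_neg]
    refine (norm_heat_term s (fun k => heatSymbol k * c k) x k).le.trans ?_
    have := heatSymbol_nonneg k
    have : t / 2 ≤ s := le_of_lt hs
    gcongr

theorem tendsto_heat_atTop (hc : PolyGrowth c) (h0 : c 0 = 0) (x : ℝ × ℝ) :
    Tendsto (fun t => heat t c x) atTop (𝓝 0) := by
  have tendsto_tsum := tendsto_tsum_of_dominated_convergence (𝓕 := atTop)
    (f := fun t k => (Real.exp (-(t * heatSymbol k)) : ℂ) * c k * TestFun.expo k x)
    (g := fun _ => 0) (hc.summable one_pos) (fun k => ?_) ?_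
  · rwa [tsum_zero] at tendsto_tsum
  · by_cases hk : k = 0
    · simp [hk, h0]
    · have tendsto_exp : Tendsto (fun t => Real.exp (-(t * heatSymbol k))) atTop (𝓝 0) :=
        Real.tendsto_exp_neg_atTop_nhds_zero.comp
          (tendsto_id.atTop_mul_const (heatSymbol_pos hk))
      have tendsto_cexp := (Complex.continuous_ofReal.tendsto 0).comp tendsto_exp
      simpa using (tendsto_cexp.mul_const (c k)).mul_const (TestFun.expo k x)
  · filter_upwards [eventually_ge_atTop 1] with s hs k
    rw [norm_heat_term]
    have := heatSymbol_nonneg k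
    gcongr

theorem norm_heat_sub_le (hc : PolyGrowth c) {x : ℝ × ℝ} {B θ : ℝ} (hθ : θ ≠ 0)
    (hb : ∀ t, 0 < t → ‖heat t (fun k => heatSymbol k * c k) x‖ ≤ B * t ^ (θ - 1)) {s : ℝ}
    (hs : 0 < s) (hst : s ≤ t) : ‖heat t c x - heat s c x‖ ≤ B / θ * (t ^ θ - s ^ θ) := by
  have hasDerivAt_heat (r : ℝ) (hr : 0 < r) : HasDerivAt (fun r => heat r c x - heat s c x)
      (-heat r (fun k => heatSymbol k * c k) x) r :=
    (hasDerivAt_heat_time hc hr x).sub_const _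
  have hasDerivAt_bound (r : ℝ) (hr : 0 < r) :
      HasDerivAt (fun r : ℝ => B / θ * (r ^ θ - s ^ θ)) (B * r ^ (θ - 1)) r :=
    (((Real.hasDerivAt_rpow_const (p := θ) (Or.inl hr.ne')).sub_const
      (s ^ θ)).const_mul (B / θ)).congr_deriv (by field_simp)
  refine image_norm_le_of_norm_deriv_right_le_deriv_boundary' (a := s) (b := t)
    (f' := fun r => -heat r (fun k => heatSymbol k * c k) x) (B' := fun r => B * r ^ (θ - 1))
    (fun r hr => (hasDerivAt_heat r (hs.trans_le hr.1)).continuousAt.continuousWithinAt)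
    (fun r hr => (hasDerivAt_heat r (hs.trans_le hr.1)).hasDerivWithinAt) (by simp)
    (fun r hr => (hasDerivAt_bound r (hs.trans_le hr.1)).continuousAt.continuousWithinAt)
    (fun r hr => (hasDerivAt_bound r (hs.trans_le hr.1)).hasDerivWithinAt)
    (fun r hr => ?_) ⟨hst, le_rfl⟩
  rw [norm_neg]
  exact hb r (hs.trans_le hr.1)

theorem norm_heat_le_of_neg (hc : PolyGrowth c) (h0 : c 0 = 0) {x : ℝ × ℝ} {B θ : ℝ} (hθ : θ < 0)
    (hb : ∀ t, 0 < t → ‖heat t (fun k => heatSymbol k * c k) x‖ ≤ B * t ^ (θ - 1)) (ht : 0 < t) :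
    ‖heat t c x‖ ≤ B / -θ * t ^ θ := by
  have tendsto_norm : Tendsto (fun r => ‖heat r c x - heat t c x‖) atTop (𝓝 ‖0 - heat t c x‖) :=
    ((tendsto_heat_atTop hc h0 x).sub_const _).norm
  have tendsto_rpow : Tendsto (fun r : ℝ => r ^ θ) atTop (𝓝 0) := by
    simpa only [neg_neg] using tendsto_rpow_neg_atTop (y := -θ) (by linarith)
  have norm_le := le_of_tendsto_of_tendsto tendsto_norm
    ((tendsto_rpow.sub_const (t ^ θ)).const_mul (B / θ)) (by
      filter_upwards [eventually_ge_atTop t] with r hr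
      exact norm_heat_sub_le hc hθ.ne hb ht hr)
  rw [zero_sub, norm_neg] at norm_le
  refine norm_le.trans (le_of_eq ?_)
  rw [div_neg]; ring

theorem tendsto_const_mul_rpow_nhdsGT_zero (B : ℝ) {θ : ℝ} (hθ : 0 < θ) :
    Tendsto (fun t : ℝ => B * t ^ θ) (𝓝[>] 0) (𝓝 0) := by
  have tendsto_rpow := (Real.continuousAt_rpow_const 0 θ (.inr hθ.le)).tendsto.const_mul B
  rw [Real.zero_rpow hθ.ne', mul_zero] at tendsto_rpow
  exact tendsto_rpow.mono_left nhdsWithin_le_nhds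

/-- The pointwise limit of `heat t c` for `t → 0`, a representative of the distribution with
Fourier coefficients `c`; it is a junk value where the limit does not exist. -/
def heatLimit (c : ℤ × ℤ → ℂ) (x : ℝ × ℝ) : ℂ := limUnder atTop fun n : ℕ => heat (1 / (n + 1)) c x

theorem norm_heatLimit_sub_le (hc : PolyGrowth c) {x : ℝ × ℝ} {B θ : ℝ} (hB : 0 ≤ B) (hθ : 0 < θ)
    (hb : ∀ t, 0 < t → ‖heat t (fun k => heatSymbol k * c k) x‖ ≤ B * t ^ (θ - 1)) (ht : 0 < t) :
    ‖heatLimit c x - heat t c x‖ ≤ B / θ * t ^ θ := by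
  have norm_sub_le {s t : ℝ} (hs : 0 < s) (hst : s ≤ t) :
      ‖heat t c x - heat s c x‖ ≤ B / θ * t ^ θ := by
    refine (norm_heat_sub_le hc hθ.ne' hb hs hst).trans ?_
    have := Real.rpow_nonneg hs.le θ
    gcongr
    linarith
  have one_div_pos (n : ℕ) : (0 : ℝ) < 1 / (n + 1) := by positivity
  have tendsto_one_div := tendsto_one_div_add_atTop_nhds_zero_nat (𝕜 := ℝ)
  have tendsto_bound := (tendsto_const_mul_rpow_nhdsGT_zero (B / θ) hθ).comp
    (tendsto_nhdsWithin_iff.2 ⟨tendsto_one_div, .of_forall one_div_pos⟩)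
  have cauchySeq_heat : CauchySeq fun n : ℕ => heat (1 / ((n : ℝ) + 1)) c x := by
    refine cauchySeq_of_le_tendsto_0' _ (fun n m hnm => ?_) tendsto_bound
    rw [dist_eq_norm]
    exact norm_sub_le (one_div_pos m) (one_div_le_one_div_of_le (by positivity) (by gcongr))
  refine le_of_tendsto (cauchySeq_heat.tendsto_limUnder.sub_const (heat t c x)).norm ?_
  filter_upwards [tendsto_one_div.eventually_le_const ht] with n hn
  rw [norm_sub_rev]
  exact norm_sub_le (one_div_pos n) hn

theorem continuous_of_norm_sub_heat_le (hc : PolyGrowth c) {u : ℝ × ℝ → ℂ} {B θ : ℝ} (hθ : 0 < θ)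
    (hu : ∀ t x, 0 < t → ‖u x - heat t c x‖ ≤ B * t ^ θ) : Continuous u := by
  refine continuous_of_uniform_approx_of_continuous fun V hV => ?_
  obtain ⟨ε, hε, hV⟩ := Metric.mem_uniformity_dist.1 hV
  obtain ⟨t, htε, ht⟩ := (((tendsto_const_mul_rpow_nhdsGT_zero B hθ).eventually_lt_const hε).and
    self_mem_nhdsWithin).exists
  refine ⟨heat t c, continuous_heat hc ht, fun x => hV ?_⟩
  rw [dist_eq_norm]
  exact (hu t x ht).trans_lt htε

theorem coeff_toDistr_of_norm_sub_heat_le (hc : PolyGrowth c) {u : PerFun} {B θ : ℝ} (hθ : 0 < θ)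
    (hu : ∀ t x, 0 < t → ‖u x - heat t c x‖ ≤ B * t ^ θ) (k : ℤ × ℤ) : u.toDistr.coeff k = c k := by
  have norm_sub_le (t : ℝ) (ht : 0 < t) :
      ‖u.toDistr.coeff k - Real.exp (-(t * heatSymbol k)) * c k‖ ≤ B * t ^ θ := by
    have integrableOn_heat := integrableOn_cell_of_continuous (continuous_heat hc ht)
    rw [← integral_heat_mul_expo hc ht k]
    change ‖(∫ x in cell, u x * TestFun.expo (-k) x) - _‖ ≤ _
    rw [← integral_sub (TestFun.integrableOn_mul u.integrable _)
      (TestFun.integrableOn_mul integrableOn_heat _)]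
    have norm_integral_le := norm_setIntegral_le_of_norm_le_const (μ := volume) (s := cell)
      (f := fun x => u x * TestFun.expo (-k) x - heat t c x * TestFun.expo (-k) x)
      (C := B * t ^ θ) (by simp [TestFun.volume_cell]) (fun x _ => by
        rw [← sub_mul, norm_mul, TestFun.norm_expo, mul_one]; exact hu t x ht)
    simpa [Measure.real, TestFun.volume_cell] using norm_integral_le
  have tendsto_norm : Tendsto
      (fun t : ℝ => ‖u.toDistr.coeff k - Real.exp (-(t * heatSymbol k)) * c k‖)
      (𝓝[>] 0) (𝓝 ‖u.toDistr.coeff k - Real.exp (-(0 * heatSymbol k)) * c k‖) :=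
    (Continuous.tendsto (by fun_prop) 0).mono_left nhdsWithin_le_nhds
  have norm_le_zero := le_of_tendsto_of_tendsto tendsto_norm
    (tendsto_const_mul_rpow_nhdsGT_zero B hθ)
    (by filter_upwards [self_mem_nhdsWithin] with t ht using norm_sub_le t ht)
  rw [zero_mul, neg_zero, Real.exp_zero, Complex.ofReal_one, one_mul] at norm_le_zero
  exact sub_eq_zero.1 (norm_le_zero_iff.1 norm_le_zero)

theorem exists_perFun_of_norm_heat_le (hc : PolyGrowth c) {B θ : ℝ} (hB : 0 ≤ B) (hθ : 0 < θ)
    (hb : ∀ t x, 0 < t → ‖heat t (fun k => heatSymbol k * c k) x‖ ≤ B * t ^ (θ - 1)) :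
    ∃ u : PerFun, (∀ k, u.toDistr.coeff k = c k) ∧
      ∀ t x, 0 < t → ‖u x - heat t c x‖ ≤ B / θ * t ^ θ := by
  have norm_sub_le : ∀ t x, 0 < t → ‖heatLimit c x - heat t c x‖ ≤ B / θ * t ^ θ := fun t x ht =>
    norm_heatLimit_sub_le hc hB hθ (fun t ht => hb t x ht) ht
  let u : PerFun :=
    { toFun := heatLimit c
      periodic := fun x => by
        simp only [heatLimit, (heat_periodic _ c x).1, (heat_periodic _ c x).2, and_self]
      integrable := integrableOn_cell_of_continuous
        (continuous_of_norm_sub_heat_le hc hθ norm_sub_le) }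
  exact ⟨u, coeff_toDistr_of_norm_sub_heat_le (u := u) hc hθ norm_sub_le, norm_sub_le⟩

end heat

/-! ### Hölder regularity from decay estimates -/

theorem aDist_pos {x y : ℝ × ℝ} (h : x ≠ y) : 0 < aDist y x := by
  unfold aDist
  by_cases hfst : y.1 = x.1
  · have hsnd : 0 < |y.2 - x.2| := abs_pos.2 fun hsnd => h (Prod.ext hfst.symm (by linarith))
    exact add_pos_of_nonneg_of_pos (abs_nonneg _) (Real.rpow_pos_of_pos hsnd _)
  · have : 0 < |y.1 - x.1| := abs_pos.2 (sub_ne_zero.2 hfst)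
    positivity

theorem abs_fst_le_aDist (x y : ℝ × ℝ) : |y.1 - x.1| ≤ aDist y x :=
  le_add_of_nonneg_right (by positivity)

theorem abs_snd_le_aDist (x y : ℝ × ℝ) : |y.2 - x.2| ≤ aDist y x ^ (3 / 2 : ℝ) := by
  have rpow_le : |y.2 - x.2| ^ (2 / 3 : ℝ) ≤ aDist y x := le_add_of_nonneg_left (abs_nonneg _)
  calc |y.2 - x.2| = (|y.2 - x.2| ^ (2 / 3 : ℝ)) ^ (3 / 2 : ℝ) := by
        rw [← Real.rpow_mul (abs_nonneg _)]; norm_num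
    _ ≤ aDist y x ^ (3 / 2 : ℝ) := by gcongr

theorem isLittleO_abs_rpow {α : ℝ} (hα : 1 < α) : (fun z : ℝ => |z| ^ α) =o[𝓝 0] fun z => z := by
  have tendsto_rpow : Tendsto (fun z : ℝ => |z| ^ (α - 1)) (𝓝 0) (𝓝 0) := by
    have continuous_rpow : Continuous fun z : ℝ => |z| ^ (α - 1) :=
      continuous_abs.rpow_const fun _ => .inr (by linarith)
    simpa [Real.zero_rpow (by linarith : α - 1 ≠ 0)] using continuous_rpow.tendsto 0
  have isLittleO_mul := ((isLittleO_one_iff ℝ).2 tendsto_rpow).mul_isBigO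
    (isBigO_refl (fun z : ℝ => |z|) (𝓝 0))
  refine (isLittleO_mul.congr_right fun z => one_mul _).of_abs_right.congr_left fun z => ?_
  rw [← Real.rpow_add_one' (abs_nonneg z) (by linarith), sub_add_cancel]

theorem hasDerivAt_of_norm_sub_le_rpow {f : ℝ → ℂ} {f' : ℂ} {a α M : ℝ} (hα : 1 < α)
    (h : ∀ s, ‖f s - f a - f' * ((s - a : ℝ) : ℂ)‖ ≤ M * |s - a| ^ α) : HasDerivAt f f' a := by
  rw [hasDerivAt_iff_isLittleO]
  have isBigO_sub : (fun s => f s - f a - (s - a) • f') =O[𝓝 a] fun s => |s - a| ^ α := by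
    refine .of_bound M (.of_forall fun s => ?_)
    rw [Real.norm_of_nonneg (by positivity), Complex.real_smul, mul_comm ((s - a : ℝ) : ℂ)]
    exact h s
  have tendsto_sub : Tendsto (fun s : ℝ => s - a) (𝓝 a) (𝓝 0) := by
    simpa using (continuous_sub_right a).tendsto a
  exact isBigO_sub.trans_isLittleO ((isLittleO_abs_rpow hα).comp_tendsto tendsto_sub)

theorem holder_le_of_le_one {α M : ℝ} (hα : α ≤ 1) {u : ℝ × ℝ → ℂ}
    (h : ∀ x y, x ≠ y → ‖u y - u x‖ ≤ M * aDist y x ^ α) : holder α u ≤ ENNReal.ofReal M := by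
  rw [holder, if_pos hα]
  refine iSup_le fun x => iSup_le fun y => iSup_le fun hxy => ENNReal.ofReal_le_ofReal ?_
  rw [div_le_iff₀ (Real.rpow_pos_of_pos (aDist_pos hxy) α)]
  exact h x y hxy

theorem holder_le_of_one_lt {α M : ℝ} (hα : 1 < α) {u v : ℝ × ℝ → ℂ}
    (h : ∀ x y, x ≠ y → ‖u y - u x - v x * ((y.1 - x.1 : ℝ) : ℂ)‖ ≤ M * aDist y x ^ α) :
    holder α u ≤ ENNReal.ofReal M := by
  have deriv_eq (x : ℝ × ℝ) : deriv (fun t : ℝ => u (t, x.2)) x.1 = v x := by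
    refine (hasDerivAt_of_norm_sub_le_rpow (M := M) hα fun s => ?_).deriv
    rcases eq_or_ne s x.1 with rfl | hs
    · simp [Real.zero_rpow (by linarith : α ≠ 0)]
    · simpa [aDist, Real.zero_rpow (by norm_num : (2 / 3 : ℝ) ≠ 0)] using
        h x (s, x.2) fun hx => hs (congrArg Prod.fst hx).symm
  rw [holder, if_neg hα.not_ge]
  refine iSup_le fun x => iSup_le fun y => iSup_le fun hxy => ENNReal.ofReal_le_ofReal ?_
  rw [div_le_iff₀ (Real.rpow_pos_of_pos (aDist_pos hxy) α), deriv_eq]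
  exact h x y hxy

theorem norm_sub_le_of_hasDerivAt {f f' : ℝ → ℂ} {C : ℝ} (hf : ∀ s, HasDerivAt f (f' s) s)
    (hC : ∀ s, ‖f' s‖ ≤ C) (a b : ℝ) : ‖f b - f a‖ ≤ C * |b - a| :=
  convex_univ.norm_image_sub_le_of_norm_hasDerivWithin_le
    (fun s _ => (hf s).hasDerivWithinAt) (fun s _ => hC s) trivial trivial

theorem norm_sub_sub_le_of_hasDerivAt {f f' f'' : ℝ → ℂ} {C : ℝ} (hf : ∀ s, HasDerivAt f (f' s) s)
    (hf' : ∀ s, HasDerivAt f' (f'' s) s) (hC : ∀ s, ‖f'' s‖ ≤ C) (a b : ℝ) :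
    ‖f b - f a - f' a * ((b - a : ℝ) : ℂ)‖ ≤ C * |b - a| ^ 2 := by
  have C_nonneg : 0 ≤ C := (norm_nonneg _).trans (hC 0)
  have norm_sub_le := (convex_uIcc a b).norm_image_sub_le_of_norm_hasDerivWithin_le
    (f := fun s => f s - f' a * (s : ℂ)) (f' := fun s => f' s - f' a) (C := C * |b - a|)
    (fun s _ => (((hf s).sub ((Complex.ofRealCLM.hasDerivAt (x := s)).const_mul
      (f' a))).congr_deriv (by simp)).hasDerivWithinAt)
    (fun s hs => (norm_sub_le_of_hasDerivAt hf' hC a s).trans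
      (mul_le_mul_of_nonneg_left (Set.abs_sub_left_of_mem_uIcc hs) C_nonneg))
    Set.left_mem_uIcc Set.right_mem_uIcc
  calc ‖f b - f a - f' a * ((b - a : ℝ) : ℂ)‖
      = ‖f b - f' a * (b : ℂ) - (f a - f' a * (a : ℂ))‖ := by congr 1; push_cast; ring
    _ ≤ C * |b - a| * |b - a| := norm_sub_le
    _ = C * |b - a| ^ 2 := by ring

theorem mul_rpow_sub_mul_le {K d a α p : ℝ} (hK : 0 ≤ K * d ^ (α - p)) (hd : 0 < d)
    (ha : a ≤ d ^ p) : K * d ^ (α - p) * a ≤ K * d ^ α := by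
  calc K * d ^ (α - p) * a ≤ K * d ^ (α - p) * d ^ p := mul_le_mul_of_nonneg_left ha hK
    _ = K * d ^ α := by rw [mul_assoc, ← Real.rpow_add hd, sub_add_cancel]

section increments

variable {w w₁ w₁₁ w₂ : ℝ × ℝ → ℂ} {C₁ C₁₁ C₂ : ℝ}

theorem norm_sub_le_of_partial_le (h₁ : ∀ a b, HasDerivAt (fun s => w (s, b)) (w₁ (a, b)) a)
    (h₂ : ∀ a b, HasDerivAt (fun s => w (a, s)) (w₂ (a, b)) b) (hC₁ : ∀ x, ‖w₁ x‖ ≤ C₁)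
    (hC₂ : ∀ x, ‖w₂ x‖ ≤ C₂) (x y : ℝ × ℝ) :
    ‖w y - w x‖ ≤ C₁ * |y.1 - x.1| + C₂ * |y.2 - x.2| := by
  have fst_le := norm_sub_le_of_hasDerivAt (h₁ · y.2) (fun _ => hC₁ _) x.1 y.1
  have snd_le := norm_sub_le_of_hasDerivAt (h₂ x.1) (fun _ => hC₂ _) x.2 y.2
  exact (norm_sub_le_norm_sub_add_norm_sub _ _ _).trans (add_le_add fst_le snd_le)

theorem norm_sub_sub_le_of_partial_le
    (h₁ : ∀ a b, HasDerivAt (fun s => w (s, b)) (w₁ (a, b)) a)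
    (h₁₁ : ∀ a b, HasDerivAt (fun s => w₁ (s, b)) (w₁₁ (a, b)) a)
    (h₂ : ∀ a b, HasDerivAt (fun s => w (a, s)) (w₂ (a, b)) b)
    (hC₁₁ : ∀ x, ‖w₁₁ x‖ ≤ C₁₁) (hC₂ : ∀ x, ‖w₂ x‖ ≤ C₂) (x y : ℝ × ℝ) :
    ‖w y - w x - w₁ x * ((y.1 - x.1 : ℝ) : ℂ)‖
      ≤ C₁₁ * |y.1 - x.1| ^ 2 + C₂ * |y.2 - x.2| := by
  have fst_le := norm_sub_sub_le_of_hasDerivAt (h₁ · x.2) (h₁₁ · x.2) (fun _ => hC₁₁ _) x.1 y.1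
  have snd_le := norm_sub_le_of_hasDerivAt (h₂ y.1) (fun _ => hC₂ _) x.2 y.2
  rw [← sub_add_sub_cancel' (w (y.1, x.2)) (w x) (w y), add_sub_right_comm]
  exact (norm_add_le _ _).trans (add_le_add fst_le snd_le)

variable {u v : ℝ × ℝ → ℂ} {K₀ K₁ K₁₁ K₂ α : ℝ} {x y : ℝ × ℝ}

theorem norm_sub_le_of_approx (hxy : x ≠ y)
    (h₁ : ∀ a b, HasDerivAt (fun s => w (s, b)) (w₁ (a, b)) a)
    (h₂ : ∀ a b, HasDerivAt (fun s => w (a, s)) (w₂ (a, b)) b)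
    (hK₀ : ∀ z, ‖u z - w z‖ ≤ K₀ * aDist y x ^ α)
    (hK₁ : ∀ z, ‖w₁ z‖ ≤ K₁ * aDist y x ^ (α - 1))
    (hK₂ : ∀ z, ‖w₂ z‖ ≤ K₂ * aDist y x ^ (α - 3 / 2)) :
    ‖u y - u x‖ ≤ (2 * K₀ + K₁ + K₂) * aDist y x ^ α := by
  have fst_le := mul_rpow_sub_mul_le ((norm_nonneg _).trans (hK₁ x)) (aDist_pos hxy)
    ((abs_fst_le_aDist x y).trans_eq (Real.rpow_one _).symm)
  have snd_le := mul_rpow_sub_mul_le ((norm_nonneg _).trans (hK₂ x)) (aDist_pos hxy)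
    (abs_snd_le_aDist x y)
  have increment_le := norm_sub_le_of_partial_le h₁ h₂ hK₁ hK₂ x y
  calc ‖u y - u x‖ = ‖(u y - w y) - (u x - w x) + (w y - w x)‖ := by congr 1; ring
    _ ≤ ‖u y - w y‖ + ‖u x - w x‖ + ‖w y - w x‖ :=
        (norm_add_le _ _).trans (by gcongr; exact norm_sub_le _ _)
    _ ≤ (2 * K₀ + K₁ + K₂) * aDist y x ^ α := by linarith [hK₀ x, hK₀ y]

theorem norm_sub_sub_le_of_approx (hxy : x ≠ y)
    (h₁ : ∀ a b, HasDerivAt (fun s => w (s, b)) (w₁ (a, b)) a)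
    (h₁₁ : ∀ a b, HasDerivAt (fun s => w₁ (s, b)) (w₁₁ (a, b)) a)
    (h₂ : ∀ a b, HasDerivAt (fun s => w (a, s)) (w₂ (a, b)) b)
    (hK₀ : ∀ z, ‖u z - w z‖ ≤ K₀ * aDist y x ^ α)
    (hK₁ : ∀ z, ‖v z - w₁ z‖ ≤ K₁ * aDist y x ^ (α - 1))
    (hK₁₁ : ∀ z, ‖w₁₁ z‖ ≤ K₁₁ * aDist y x ^ (α - 2))
    (hK₂ : ∀ z, ‖w₂ z‖ ≤ K₂ * aDist y x ^ (α - 3 / 2)) :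
    ‖u y - u x - v x * ((y.1 - x.1 : ℝ) : ℂ)‖
      ≤ (2 * K₀ + K₁ + K₁₁ + K₂) * aDist y x ^ α := by
  have hd := aDist_pos hxy
  have slope_le : ‖(v x - w₁ x) * ((y.1 - x.1 : ℝ) : ℂ)‖ ≤ K₁ * aDist y x ^ α := by
    rw [norm_mul, Complex.norm_real, Real.norm_eq_abs]
    exact (mul_le_mul_of_nonneg_right (hK₁ x) (abs_nonneg _)).trans
      (mul_rpow_sub_mul_le ((norm_nonneg _).trans (hK₁ x)) hd
        ((abs_fst_le_aDist x y).trans_eq (Real.rpow_one _).symm))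
  have fst_le := mul_rpow_sub_mul_le (a := |y.1 - x.1| ^ 2) ((norm_nonneg _).trans (hK₁₁ x)) hd
    ((pow_le_pow_left₀ (abs_nonneg _) (abs_fst_le_aDist x y) 2).trans_eq
      (Real.rpow_two _).symm)
  have snd_le := mul_rpow_sub_mul_le ((norm_nonneg _).trans (hK₂ x)) hd (abs_snd_le_aDist x y)
  have increment_le := norm_sub_sub_le_of_partial_le h₁ h₁₁ h₂ hK₁₁ hK₂ x y
  calc ‖u y - u x - v x * ((y.1 - x.1 : ℝ) : ℂ)‖
      = ‖(u y - w y) - (u x - w x) + (w y - w x - w₁ x * ((y.1 - x.1 : ℝ) : ℂ))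
          - (v x - w₁ x) * ((y.1 - x.1 : ℝ) : ℂ)‖ := by congr 1; ring
    _ ≤ ‖u y - w y‖ + ‖u x - w x‖ + ‖w y - w x - w₁ x * ((y.1 - x.1 : ℝ) : ℂ)‖
          + ‖(v x - w₁ x) * ((y.1 - x.1 : ℝ) : ℂ)‖ :=
        (norm_sub_le _ _).trans (by
          gcongr
          exact (norm_add_le _ _).trans (by gcongr; exact norm_sub_le _ _))
    _ ≤ (2 * K₀ + K₁ + K₁₁ + K₂) * aDist y x ^ α := by linarith [hK₀ x, hK₀ y]

end increments

theorem rpow_cube {d : ℝ} (hd : 0 < d) (θ : ℝ) : (d ^ 3) ^ θ = d ^ (3 * θ) := by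
  rw [← Real.rpow_natCast, ← Real.rpow_mul hd.le]; norm_num

/-- The decay estimates, for the time derivative of the semigroup, that encode regularity of
order `α` of the distribution with Fourier coefficients `c`. -/
def HeatBound (α B : ℝ) (c : ℤ × ℤ → ℂ) : Prop :=
  ∀ i j : ℕ, i ≤ 2 → j ≤ 1 → ∀ (t : ℝ) (x : ℝ × ℝ), 0 < t →
    ‖heat t (fun k => heatSymbol k * derivCoeff i j c k) x‖
      ≤ B * t ^ ((α - (i + 3 / 2 * j)) / 3 - 1)

namespace HeatBound

variable {α B : ℝ} {c : ℤ × ℤ → ℂ} {i j : ℕ} {p : ℝ}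

theorem norm_heat_cube_le (h : HeatBound α B c) (hc : PolyGrowth c) (h0 : c 0 = 0) (hi : i ≤ 2)
    (hj : j ≤ 1) (hp : i + 3 / 2 * j = p) (hαp : α < p) {d : ℝ} (hd : 0 < d) (x : ℝ × ℝ) :
    ‖heat (d ^ 3) (derivCoeff i j c) x‖ ≤ 3 / (p - α) * B * d ^ (α - p) := by
  refine (norm_heat_le_of_neg (hc.derivCoeff i j) (by simp [derivCoeff, h0])
    (θ := (α - p) / 3) (by linarith) (fun t ht => hp ▸ h i j hi hj t x ht)
    (by positivity)).trans (le_of_eq ?_)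
  have : p - α ≠ 0 := by linarith
  have : -((α - p) / 3) = (p - α) / 3 := by ring
  rw [rpow_cube hd, this, mul_div_cancel₀ _ (three_ne_zero (α := ℝ))]
  field_simp

theorem exists_perFun (h : HeatBound α B c) (hB : 0 ≤ B) (hc : PolyGrowth c) (hi : i ≤ 2)
    (hj : j ≤ 1) (hp : i + 3 / 2 * j = p) (hpα : p < α) :
    ∃ u : PerFun, (∀ k, u.toDistr.coeff k = derivCoeff i j c k) ∧ ∀ d x, 0 < d →
      ‖u x - heat (d ^ 3) (derivCoeff i j c) x‖ ≤ 3 / (α - p) * B * d ^ (α - p) := by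
  obtain ⟨u, coeff_u, norm_sub_le⟩ := exists_perFun_of_norm_heat_le (hc.derivCoeff i j) hB
    (θ := (α - p) / 3) (by linarith) fun t x ht => hp ▸ h i j hi hj t x ht
  refine ⟨u, coeff_u, fun d x hd => (norm_sub_le (d ^ 3) x (by positivity)).trans (le_of_eq ?_)⟩
  have : α - p ≠ 0 := by linarith
  rw [rpow_cube hd, mul_div_cancel₀ _ (three_ne_zero (α := ℝ))]
  field_simp

end HeatBound

theorem exists_holder_le_of_lt_one {α : ℝ} (h0 : 0 < α) (h1 : α < 1) :
    ∃ M, 0 ≤ M ∧ ∀ (c : ℤ × ℤ → ℂ) (B : ℝ), 0 ≤ B → PolyGrowth c → c 0 = 0 → HeatBound α B c →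
      ∃ u : PerFun, (∀ k, u.toDistr.coeff k = c k) ∧ holder α u ≤ ENNReal.ofReal (M * B) := by
  have : 0 < 1 - α := by linarith
  have : 0 < 3 / 2 - α := by linarith
  refine ⟨2 * (3 / α) + 3 / (1 - α) + 3 / (3 / 2 - α), by positivity, fun c B hB hc hc0 h => ?_⟩
  obtain ⟨u, coeff_u, norm_sub_heat_le⟩ :=
    h.exists_perFun hB hc (i := 0) (j := 0) (p := 0) (by norm_num) (by norm_num) (by norm_num) h0
  simp only [derivCoeff_zero_zero] at coeff_u
  simp only [sub_zero] at norm_sub_heat_le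
  refine ⟨u, coeff_u, holder_le_of_le_one h1.le fun x y hxy => ?_⟩
  have hd := aDist_pos hxy
  have ht : 0 < aDist y x ^ 3 := by positivity
  have increment_le := norm_sub_le_of_approx hxy
    (hasDerivAt_heat_fst hc ht 0 0) (hasDerivAt_heat_snd hc ht 0 0)
    (fun z => norm_sub_heat_le _ z hd)
    (h.norm_heat_cube_le hc hc0 (by norm_num) (by norm_num) (by norm_num) (by linarith) hd)
    (h.norm_heat_cube_le hc hc0 (by norm_num) (by norm_num) (by norm_num) (by linarith) hd)
  exact increment_le.trans_eq (by ring)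

theorem exists_holder_le_of_one_lt {α : ℝ} (h1 : 1 < α) (h2 : α < 3 / 2) :
    ∃ M, 0 ≤ M ∧ ∀ (c : ℤ × ℤ → ℂ) (B : ℝ), 0 ≤ B → PolyGrowth c → c 0 = 0 → HeatBound α B c →
      ∃ u : PerFun, (∀ k, u.toDistr.coeff k = c k) ∧ holder α u ≤ ENNReal.ofReal (M * B) := by
  have : 0 < α - 1 := by linarith
  have : 0 < 2 - α := by linarith
  have : 0 < 3 / 2 - α := by linarith
  refine ⟨2 * (3 / α) + 3 / (α - 1) + 3 / (2 - α) + 3 / (3 / 2 - α), by positivity,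
    fun c B hB hc hc0 h => ?_⟩
  obtain ⟨u, coeff_u, norm_sub_heat_le⟩ := h.exists_perFun hB hc (i := 0) (j := 0) (p := 0)
    (by norm_num) (by norm_num) (by norm_num) (by linarith)
  obtain ⟨v, -, norm_sub_heat_fst_le⟩ := h.exists_perFun hB hc (i := 1) (j := 0) (p := 1)
    (by norm_num) (by norm_num) (by norm_num) h1
  simp only [derivCoeff_zero_zero] at coeff_u
  simp only [sub_zero] at norm_sub_heat_le
  refine ⟨u, coeff_u, holder_le_of_one_lt h1 (v := v) fun x y hxy => ?_⟩
  have hd := aDist_pos hxy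
  have ht : 0 < aDist y x ^ 3 := by positivity
  have increment_le := norm_sub_sub_le_of_approx hxy (hasDerivAt_heat_fst hc ht 0 0)
    (hasDerivAt_heat_fst hc ht 1 0) (hasDerivAt_heat_snd hc ht 0 0)
    (fun z => norm_sub_heat_le _ z hd) (fun z => norm_sub_heat_fst_le _ z hd)
    (h.norm_heat_cube_le hc hc0 (by norm_num) (by norm_num) (by norm_num) (by linarith) hd)
    (h.norm_heat_cube_le hc hc0 (by norm_num) (by norm_num) (by norm_num) (by linarith) hd)
  exact increment_le.trans_eq (by ring)

/-! ### Fourier series of smooth periodic functions -/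

theorem eq_zero_of_forall_integral_fourier_eq_zero {g : ℝ → ℂ} (hg : Continuous g)
    (hp : Function.Periodic g 1)
    (h : ∀ n : ℤ, ∫ z in (0 : ℝ)..1, fourier n (z : UnitAddCircle) * g z = 0) (z : ℝ) :
    g z = 0 := by
  let G : C(UnitAddCircle, ℂ) :=
    ⟨hp.lift, (QuotientAddGroup.isQuotientMap_mk _).continuous_iff.2 hg⟩
  have fourierCoeff_eq_zero : fourierCoeff G = 0 := funext fun n => by
    rw [fourierCoeff_eq_intervalIntegral _ n 0, zero_add, div_one, one_smul]
    exact h (-n)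
  have hasSum := has_pointwise_sum_fourier_series_of_summable (f := G)
    (fourierCoeff_eq_zero ▸ summable_zero) (z : UnitAddCircle)
  simp only [fourierCoeff_eq_zero, Pi.zero_apply, zero_smul] at hasSum
  exact hasSum.unique hasSum_zero

theorem eq_zero_of_forall_integral_expo_eq_zero {g : ℝ × ℝ → ℂ} (hg : Continuous g)
    (hp : IsPeriodic g) (h : ∀ k, ∫ x in cell, TestFun.expo k x * g x = 0) (x : ℝ × ℝ) :
    g x = 0 := by
  refine eq_zero_of_forall_integral_fourier_eq_zero (g := fun b => g (x.1, b)) (by fun_prop)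
    (fun b => (hp (x.1, b)).2) (fun n => ?_) x.2
  refine eq_zero_of_forall_integral_fourier_eq_zero
    (g := fun a => ∫ b in (0 : ℝ)..1, fourier n (b : UnitAddCircle) * g (a, b)) ?_ (fun a => ?_)
    (fun m => ?_) x.1
  · refine intervalIntegral.continuous_parametric_intervalIntegral_of_continuous' ?_ _ _
    exact (((fourier n).continuous.comp (AddCircle.continuous_mk' 1)).comp continuous_snd).mul hg
  · simp only [(hp (a, _)).1]
  · have integral_eq_zero := h (m, n)
    have integrableOn_mul : IntegrableOn (fun x => TestFun.expo (m, n) x * g x) cell :=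
      integrableOn_cell_of_continuous ((TestFun.expo (m, n)).continuous.mul hg)
    rw [cell, Measure.volume_eq_prod, setIntegral_prod _ integrableOn_mul] at integral_eq_zero
    simp only [intervalIntegral.integral_of_le zero_le_one, ← integral_Ico_eq_integral_Ioc]
    simpa only [expo_eq_fourier_mul, mul_assoc, integral_const_mul] using integral_eq_zero

namespace TestFun

theorem summable_norm_fourier (φ : TestFun) : Summable fun k => ‖fourier k φ‖ := by
  let K := 4 ^ 2 * 4 *
    (({(0, 0), (2, 0), (0, 2), (2, 2)} : Finset (ℕ × ℕ)).sup seminorms) φ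
  refine Summable.of_nonneg_of_le (fun _ => norm_nonneg _) (fun k => ?_)
    (PerDistr.summable_weight.mul_left K)
  rw [PerDistr.weight, one_div_mul_one_div, mul_one_div, le_div_iff₀ (by positivity)]
  linarith [PerDistr.decay 2 φ k]

theorem tsum_fourier_mul_expo (φ : TestFun) (x : ℝ × ℝ) :
    ∑' k, fourier k φ * expo k x = φ x := by
  let S : ℝ × ℝ → ℂ := fun x => ∑' k, fourier k φ * expo k x
  have continuous_S : Continuous S := continuous_tsum_mul_expo φ.summable_norm_fourier
  refine eq_of_sub_eq_zero (eq_zero_of_forall_integral_expo_eq_zero (g := fun x => S x - φ x)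
    (continuous_S.sub φ.continuous) (fun x => ?_) (fun l => ?_) x)
  · simp only [S, ((expo _).periodic x).1, ((expo _).periodic x).2, (φ.periodic x).1,
      (φ.periodic x).2, and_self]
  have integral_S : ∫ x in cell, S x * expo l x = fourier (-l) φ := by
    simpa only [neg_neg] using integral_tsum_mul_expo φ.summable_norm_fourier (-l)
  have integral_φ : ∫ x in cell, φ x * expo l x = fourier (-l) φ := by
    simp only [fourier_apply, neg_neg, mul_comm]
  simp only [mul_comm (expo l _), sub_mul]
  rw [integral_sub (integrableOn_mul (integrableOn_cell_of_continuous continuous_S) _)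
    (integrableOn_mul φ.integrableOn _), integral_S, integral_φ, sub_self]

theorem fourier_d1_pow (j : ℕ) (k : ℤ × ℤ) (φ : TestFun) :
    fourier k ((d1 ^ j) φ) = (2 * Real.pi * Complex.I * k.1) ^ j * fourier k φ := by
  induction j generalizing φ with
  | zero => simp
  | succ j ih => rw [pow_succ, Module.End.mul_apply, ih, fourier_d1]; ring

theorem fourier_d2_pow (l : ℕ) (k : ℤ × ℤ) (φ : TestFun) :
    fourier k ((d2 ^ l) φ) = (2 * Real.pi * Complex.I * k.2) ^ l * fourier k φ := by
  induction l generalizing φ with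
  | zero => simp
  | succ l ih => rw [pow_succ, Module.End.mul_apply, ih, fourier_d2]; ring

theorem sum_smul_apply (s : Finset (ℤ × ℤ)) (a : ℤ × ℤ → ℂ) (F : ℤ × ℤ → TestFun) (x : ℝ × ℝ) :
    (∑ k ∈ s, a k • F k) x = ∑ k ∈ s, a k * F k x := by
  induction s using Finset.cons_induction with
  | empty => rfl
  | cons k s hk ih => rw [Finset.sum_cons, Finset.sum_cons, add_apply, ih]; rfl

theorem sum_fourier_smul_expo_d_pow (s : Finset (ℤ × ℤ)) (j l : ℕ) (φ : TestFun) :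
    (d1 ^ j) ((d2 ^ l) (∑ k ∈ s, fourier k φ • expo k))
      = ∑ k ∈ s, fourier k ((d1 ^ j) ((d2 ^ l) φ)) • expo k := by
  simp only [map_sum, map_smul, d_pow_expo, smul_smul]
  refine Finset.sum_congr rfl fun k _ => ?_
  rw [fourier_d1_pow, fourier_d2_pow]
  congr 1; ring

theorem hasSum_fourier (φ : TestFun) : HasSum (fun k => fourier k φ • expo k) φ := by
  refine (withSeminorms.tendsto_nhds _ _).2 fun jl ε hε => ?_
  let ψ := (d1 ^ jl.1) ((d2 ^ jl.2) φ)
  have tendstoUniformly_sum := tendstoUniformly_tsum (f := fun k x => fourier k ψ * expo k x)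
    ψ.summable_norm_fourier (fun k x => by rw [norm_mul, norm_expo, mul_one])
  simp only [tsum_fourier_mul_expo] at tendstoUniformly_sum
  filter_upwards [Metric.tendstoUniformly_iff.1 tendstoUniformly_sum (ε / 2) (half_pos hε)]
    with s hs
  refine lt_of_le_of_lt ?_ (half_lt_self hε)
  rw [seminorms_apply, map_sub, map_sub, sum_fourier_smul_expo_d_pow]
  refine supNorm_le fun x => ?_
  change ‖(∑ k ∈ s, fourier k ψ • expo k) x - ψ x‖ ≤ ε / 2
  rw [sum_smul_apply, ← dist_eq_norm, dist_comm]
  exact (hs x).le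

end TestFun

theorem PerDistr.hasSum_fourier_mul_coeff (f : PerDistr) (φ : TestFun) :
    HasSum (fun k => TestFun.fourier k φ * f.coeff (-k)) (f φ) := by
  simpa only [map_smul, smul_eq_mul, PerDistr.coeff, neg_neg] using φ.hasSum_fourier.mapL f

theorem PerDistr.ext_coeff {f g : PerDistr} (h : ∀ k, f.coeff k = g.coeff k) : f = g :=
  ContinuousLinearMap.ext fun φ => (f.hasSum_fourier_mul_coeff φ).unique
    (by simpa only [h] using g.hasSum_fourier_mul_coeff φ)

/-! ### Decay estimates for negative Hölder regularity -/

/-- The symbol of the power `R ^ l` of the Hilbert transform, as a function of the first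
frequency; `l = 0` stands for `f` itself and `l = 1` for `R f`. For `l = 0` it is `1` also at the
frequency `0`. -/
def hilbertPow (l : ℕ) (n : ℤ) : ℂ := (Complex.I * (n.sign : ℂ)) ^ l

theorem hilbertPow_sign (l : ℕ) (n : ℤ) : hilbertPow l n.sign = hilbertPow l n := by
  simp only [hilbertPow, Int.sign_sign]

theorem hilbertPow_add (l l' : ℕ) (n : ℤ) :
    hilbertPow (l + l') n = hilbertPow l n * hilbertPow l' n := pow_add _ _ _

theorem norm_hilbertPow_le_one (l : ℕ) (n : ℤ) : ‖hilbertPow l n‖ ≤ 1 := by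
  rw [hilbertPow, norm_pow, norm_mul, Complex.norm_I, one_mul]
  refine pow_le_one₀ (norm_nonneg _) ?_
  rcases lt_trichotomy n 0 with h | h | h
  · simp [Int.sign_eq_neg_one_of_neg h]
  · simp [h]
  · simp [Int.sign_eq_one_of_pos h]

theorem two_pi_I_mul_int_pow (n : ℤ) (l : ℕ) : (2 * Real.pi * Complex.I * n : ℂ) ^ l
    = hilbertPow l n * ((2 * Real.pi * |(n : ℝ)| : ℝ) : ℂ) ^ l := by
  have sign_mul_abs : (n : ℂ) = (n.sign : ℂ) * ((|(n : ℝ)| : ℝ) : ℂ) := by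
    rw [← Int.cast_abs, Complex.ofReal_intCast]
    exact_mod_cast (Int.sign_mul_abs n).symm
  rw [hilbertPow, ← mul_pow, Complex.ofReal_mul]
  nth_rewrite 1 [sign_mul_abs]
  congr 1; push_cast; ring

/-- The Fourier coefficients of `R ^ l |∂₁| ^ a ∂₂ ^ b u`. Both `∂₁ = R |∂₁|` and the operators
`R`, `|∂₁|` of the equation lead to terms of this form. -/
def multCoeff (l a b : ℕ) (u : PerFun) (k : ℤ × ℤ) : ℂ :=
  hilbertPow l k.1 * ((2 * Real.pi * |(k.1 : ℝ)| : ℝ) : ℂ) ^ a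
    * (2 * Real.pi * Complex.I * k.2) ^ b * u.toDistr.coeff k

theorem polyGrowth_multCoeff (l a b : ℕ) (u : PerFun) : PolyGrowth (multCoeff l a b u) := by
  have abs_fst : PolyGrowth fun k => ((2 * Real.pi * |(k.1 : ℝ)| : ℝ) : ℂ) :=
    PolyGrowth.fst.of_norm_le fun k => by
      rw [norm_two_pi_I_mul_int, Complex.norm_real, Real.norm_of_nonneg (by positivity)]
  exact (((PolyGrowth.of_bounded fun k => norm_hilbertPow_le_one l k.1).mul (abs_fst.pow a)).mul
    (PolyGrowth.snd.pow b)).mul (PolyGrowth.of_bounded (norm_coeff_toDistr_le u))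

theorem heat_multCoeff {t r₁ r₂ : ℝ} (hr₁ : r₁ ^ 3 = t) (hr₂ : r₂ ^ 2 = t) (l a b : ℕ)
    (u : PerFun) (x : ℝ × ℝ) :
    ∑' k : ℤ × ℤ, signedSymbol (hilbertPow l) (powMulExp 3 a) (2 * Real.pi * r₁) k.1
        * signedSymbol (hilbertPow b) (powMulExp 2 b) (2 * Real.pi * r₂) k.2
        * u.toDistr.coeff k * TestFun.expo k x
      = ((r₁ ^ a * r₂ ^ b : ℝ) : ℂ) * heat t (multCoeff l a b u) x := by
  rw [heat, ← tsum_mul_left]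
  refine tsum_congr fun k => ?_
  have exp_split : Real.exp (-(t * heatSymbol k))
      = Real.exp (-(2 * Real.pi * r₁ * |(k.1 : ℝ)|) ^ 3)
        * Real.exp (-(2 * Real.pi * r₂ * |(k.2 : ℝ)|) ^ 2) := by
    rw [← Real.exp_add, heatSymbol]
    congr 1
    linear_combination (2 * Real.pi * |(k.1 : ℝ)|) ^ 3 * hr₁
      + (2 * Real.pi * |(k.2 : ℝ)|) ^ 2 * hr₂ + t * (2 * Real.pi) ^ 2 * sq_abs (k.2 : ℝ)
  rw [exp_split, multCoeff, two_pi_I_mul_int_pow]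
  simp only [signedSymbol, powMulExp, hilbertPow_sign]
  push_cast
  ring

theorem rpow_natCast_div_pow {t : ℝ} (ht : 0 < t) (p a : ℕ) :
    (t ^ (1 / p : ℝ)) ^ a = t ^ ((a : ℝ) / p) := by
  rw [← Real.rpow_natCast, ← Real.rpow_mul ht.le]
  congr 1; ring

theorem exists_norm_heat_multCoeff_le_scaled {s : ℝ} (h0 : 0 ≤ s) (h1 : s < 1) {a : ℕ}
    (ha : a ≠ 0) (b : ℕ) : ∃ D, 0 ≤ D ∧ ∀ (u : PerFun) (G : ℝ) (l : ℕ), 0 ≤ G →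
      (∀ x y, ‖u y - u x‖ ≤ G * aDist y x ^ s) → ∀ t r₁ r₂ x, 0 < r₁ → 0 < r₂ →
      r₁ ^ 3 = t → r₂ ^ 2 = t →
      r₁ ^ a * r₂ ^ b * ‖heat t (multCoeff l a b u) x‖
        ≤ D * ((2 * Real.pi * r₁) ^ s + (2 * Real.pi * r₂) ^ (2 / 3 * s)) * G := by
  obtain ⟨D, hD, norm_tsum_le⟩ := exists_norm_tsum_coeff_le h0 h1
  obtain ⟨C₁, isKernelSymbol₁⟩ := (isProfile_powMulExp three_ne_zero a).exists_isKernelSymbol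
  obtain ⟨C₂, isKernelSymbol₂⟩ := (isProfile_powMulExp two_ne_zero b).exists_isKernelSymbol
  have symbol₁ (l : ℕ) {r : ℝ} (hr : 0 < r) :=
    isKernelSymbol₁ (hilbertPow l) r (norm_hilbertPow_le_one l)
      (fun n => by rw [powMulExp_zero 3 ha, Complex.ofReal_zero, mul_zero, mul_zero]) hr
  have symbol₂ {r : ℝ} (hr : 0 < r) :=
    isKernelSymbol₂ (hilbertPow b) r (norm_hilbertPow_le_one b) (fun n => by
      rcases eq_or_ne b 0 with rfl | hb
      · simp only [hilbertPow, pow_zero]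
      · rw [powMulExp_zero 2 hb, Complex.ofReal_zero, mul_zero, mul_zero]) hr
  have hC₁ : 0 ≤ C₁ := (symbol₁ 0 one_pos).nonneg
  have hC₂ : 0 ≤ C₂ := (symbol₂ one_pos).nonneg
  refine ⟨D * (C₁ * C₂), by positivity, fun u G l hG hu t r₁ r₂ x hr₁ hr₂ cube square => ?_⟩
  have norm_le := norm_tsum_le u G C₁ C₂ _ _ _ _ hG hu
    (symbol₁ l (r := 2 * Real.pi * r₁) (by positivity))
    (symbol₂ (r := 2 * Real.pi * r₂) (by positivity))
    (by simp [signedSymbol, powMulExp_zero 3 ha]) x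
  rwa [heat_multCoeff cube square, norm_mul, Complex.norm_real,
    Real.norm_of_nonneg (by positivity)] at norm_le

theorem exists_norm_heat_multCoeff_le {s : ℝ} (h0 : 0 ≤ s) (h1 : s < 1) {a : ℕ} (ha : a ≠ 0)
    (b : ℕ) : ∃ D, 0 ≤ D ∧ ∀ (u : PerFun) (G : ℝ) (l : ℕ), 0 ≤ G →
      (∀ x y, ‖u y - u x‖ ≤ G * aDist y x ^ s) → ∀ t x, 0 < t →
      ‖heat t (multCoeff l a b u) x‖ ≤ D * G * t ^ (s / 3 - (a / 3 + b / 2)) := by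
  obtain ⟨D, hD, norm_le⟩ := exists_norm_heat_multCoeff_le_scaled h0 h1 ha b
  refine ⟨D * ((2 * Real.pi) ^ s + (2 * Real.pi) ^ (2 / 3 * s)), by positivity,
    fun u G l hG hu t x ht => ?_⟩
  have cube : (t ^ (1 / (3 : ℕ) : ℝ)) ^ 3 = t := by
    rw [rpow_natCast_div_pow ht]; norm_num
  have square : (t ^ (1 / (2 : ℕ) : ℝ)) ^ 2 = t := by
    rw [rpow_natCast_div_pow ht]; norm_num
  have scaled := norm_le u G l hG hu t _ _ x (by positivity) (by positivity) cube square
  have pow_mul_pow : (t ^ (1 / (3 : ℕ) : ℝ)) ^ a * (t ^ (1 / (2 : ℕ) : ℝ)) ^ b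
      = t ^ ((a : ℝ) / 3 + b / 2) := by
    rw [rpow_natCast_div_pow ht, rpow_natCast_div_pow ht, Real.rpow_add ht]; norm_cast
  have mul_rpow₁ : (2 * Real.pi * t ^ (1 / (3 : ℕ) : ℝ)) ^ s
      = (2 * Real.pi) ^ s * t ^ (s / 3) := by
    rw [Real.mul_rpow (by positivity) (by positivity), ← Real.rpow_mul ht.le]
    congr 2; push_cast; ring
  have mul_rpow₂ : (2 * Real.pi * t ^ (1 / (2 : ℕ) : ℝ)) ^ (2 / 3 * s)
      = (2 * Real.pi) ^ (2 / 3 * s) * t ^ (s / 3) := by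
    rw [Real.mul_rpow (by positivity) (by positivity), ← Real.rpow_mul ht.le]
    congr 2; push_cast; ring
  rw [pow_mul_pow, mul_rpow₁, mul_rpow₂, mul_comm, ← le_div_iff₀ (by positivity)] at scaled
  refine scaled.trans_eq ?_
  rw [Real.rpow_sub ht]
  ring

/-- `c` is the family of Fourier coefficients of `R ^ l f` for a solution `f` of
`ℒ f = ∂₁ ^ e g + ∂₂ h`. The equation is multiplied by the symbol of `|∂₁|`, which turns that of
`ℒ` into `heatSymbol` and removes constants from the right-hand side. -/
def IsSolution (e l : ℕ) (g h : PerFun) (c : ℤ × ℤ → ℂ) : Prop :=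
  ∀ k, heatSymbol k * c k = hilbertPow l k.1 * ((2 * Real.pi * |(k.1 : ℝ)| : ℝ) : ℂ)
    * ((2 * Real.pi * Complex.I * k.1) ^ e * g.toDistr.coeff k
      + 2 * Real.pi * Complex.I * k.2 * h.toDistr.coeff k)

theorem IsSolution.heatSymbol_mul_derivCoeff {e l : ℕ} {g h : PerFun} {c : ℤ × ℤ → ℂ}
    (hc : IsSolution e l g h c) (i j : ℕ) (k : ℤ × ℤ) :
    heatSymbol k * derivCoeff i j c k
      = multCoeff (l + (i + e)) (i + e + 1) j g k + multCoeff (l + i) (i + 1) (j + 1) h k := by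
  rw [derivCoeff, mul_left_comm, hc k, multCoeff, multCoeff, hilbertPow_add l, hilbertPow_add l,
    hilbertPow_add i, two_pi_I_mul_int_pow k.1, two_pi_I_mul_int_pow k.1]
  ring

theorem exists_norm_heat_mul_derivCoeff_le {α : ℝ} {e : ℕ} (he : 0 ≤ α - 2 + e)
    (he' : α - 2 + e < 1) (h0 : 0 ≤ α - 1 / 2) (h1 : α - 1 / 2 < 1) (i j : ℕ) :
    ∃ D, 0 ≤ D ∧ ∀ (l : ℕ) (c : ℤ × ℤ → ℂ) (g h : PerFun) (G H : ℝ), 0 ≤ G → 0 ≤ H →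
      (∀ x y, ‖g y - g x‖ ≤ G * aDist y x ^ (α - 2 + e)) →
      (∀ x y, ‖h y - h x‖ ≤ H * aDist y x ^ (α - 1 / 2)) → IsSolution e l g h c →
      ∀ t x, 0 < t → ‖heat t (fun k => heatSymbol k * derivCoeff i j c k) x‖
        ≤ D * (G + H) * t ^ ((α - (i + 3 / 2 * j)) / 3 - 1) := by
  obtain ⟨D₁, hD₁, norm_le₁⟩ :=
    exists_norm_heat_multCoeff_le he he' (i + e).succ_ne_zero j
  obtain ⟨D₂, hD₂, norm_le₂⟩ := exists_norm_heat_multCoeff_le h0 h1 i.succ_ne_zero (j + 1)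
  refine ⟨D₁ + D₂, by positivity, fun l c g h G H hG hH hg hh hc t x ht => ?_⟩
  have le₁ := norm_le₁ g G (l + (i + e)) hG hg t x ht
  have le₂ := norm_le₂ h H (l + i) hH hh t x ht
  have exponent₁ : (α - 2 + e) / 3 - (((i + e + 1 : ℕ) : ℝ) / 3 + j / 2)
      = (α - (i + 3 / 2 * j)) / 3 - 1 := by push_cast; ring
  have exponent₂ : (α - 1 / 2) / 3 - (((i + 1 : ℕ) : ℝ) / 3 + ((j + 1 : ℕ) : ℝ) / 2)
      = (α - (i + 3 / 2 * j)) / 3 - 1 := by push_cast; ring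
  rw [exponent₁] at le₁
  rw [exponent₂] at le₂
  rw [funext (hc.heatSymbol_mul_derivCoeff i j),
    heat_add (polyGrowth_multCoeff _ _ _ _) (polyGrowth_multCoeff _ _ _ _) ht]
  refine (norm_add_le_of_le le₁ le₂).trans ?_
  rw [← add_mul]
  gcongr
  nlinarith [mul_nonneg hD₁ hH, mul_nonneg hD₂ hG]

theorem exists_heatBound {α : ℝ} {e : ℕ} (he : 0 ≤ α - 2 + e) (he' : α - 2 + e < 1)
    (h0 : 0 ≤ α - 1 / 2) (h1 : α - 1 / 2 < 1) :
    ∃ D, 0 ≤ D ∧ ∀ (l : ℕ) (c : ℤ × ℤ → ℂ) (g h : PerFun) (G H : ℝ), 0 ≤ G → 0 ≤ H →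
      (∀ x y, ‖g y - g x‖ ≤ G * aDist y x ^ (α - 2 + e)) →
      (∀ x y, ‖h y - h x‖ ≤ H * aDist y x ^ (α - 1 / 2)) → IsSolution e l g h c →
      HeatBound α (D * (G + H)) c := by
  choose D hD norm_le using exists_norm_heat_mul_derivCoeff_le he he' h0 h1
  refine ⟨∑ p ∈ Finset.range 3 ×ˢ Finset.range 2, D p.1 p.2, Finset.sum_nonneg fun p _ => hD _ _,
    fun l c g h G H hG hH hg hh hc i j hi hj t x ht =>
      (norm_le i j l c g h G H hG hH hg hh hc t x ht).trans ?_⟩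
  have D_le : D i j ≤ ∑ p ∈ Finset.range 3 ×ˢ Finset.range 2, D p.1 p.2 :=
    Finset.single_le_sum (f := fun p : ℕ × ℕ => D p.1 p.2) (a := (i, j)) (fun p _ => hD _ _)
      (by simp; omega)
  gcongr

/-! ### The Schauder estimate -/

theorem norm_sub_le_of_holder {s : ℝ} (h0 : 0 < s) (h1 : s ≤ 1) {u : ℝ × ℝ → ℂ}
    (h : holder s u ≠ ⊤) (x y : ℝ × ℝ) : ‖u y - u x‖ ≤ (holder s u).toReal * aDist y x ^ s := by
  by_cases hxy : x = y
  · have aDist_self : aDist x x = 0 := by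
      simp [aDist, Real.zero_rpow (by norm_num : (2 / 3 : ℝ) ≠ 0)]
    simp [← hxy, aDist_self, Real.zero_rpow h0.ne']
  · rw [← div_le_iff₀ (Real.rpow_pos_of_pos (aDist_pos hxy) s)]
    refine (ENNReal.ofReal_le_iff_le_toReal h).1 ?_
    rw [holder, if_pos h1]
    exact le_iSup_of_le x (le_iSup_of_le y (le_iSup_of_le hxy le_rfl))

theorem coeff_d1 (f : PerDistr) (k : ℤ × ℤ) :
    f.d1.coeff k = 2 * Real.pi * Complex.I * k.1 * f.coeff k := by
  change -(f (TestFun.d1 (TestFun.expo (-k)))) = _ * f (TestFun.expo (-k))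
  rw [TestFun.d1_expo, map_smul, smul_eq_mul, Prod.fst_neg]
  push_cast; ring

theorem coeff_d2 (f : PerDistr) (k : ℤ × ℤ) :
    f.d2.coeff k = 2 * Real.pi * Complex.I * k.2 * f.coeff k := by
  change -(f (TestFun.d2 (TestFun.expo (-k)))) = _ * f (TestFun.expo (-k))
  rw [TestFun.d2_expo, map_smul, smul_eq_mul, Prod.snd_neg]
  push_cast; ring

theorem coeff_add (f g : PerDistr) (k : ℤ × ℤ) : (f + g).coeff k = f.coeff k + g.coeff k := rfl

theorem coeff_opL (f : PerDistr) (k : ℤ × ℤ) :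
    f.opL.coeff k = ((2 * Real.pi * k.1) ^ 2 + PerDistr.absInvSymbol k * (2 * Real.pi * k.2) ^ 2)
      * f.coeff k := by
  change -(f.d1.d1.coeff k) - f.d2.d2.absInv.coeff k = _
  rw [PerDistr.absInv, PerDistr.coeff_multiplier, coeff_d1, coeff_d1, coeff_d2, coeff_d2]
  linear_combination (-(2 * Real.pi * k.1) ^ 2 * f.coeff k
    - PerDistr.absInvSymbol k * (2 * Real.pi * k.2) ^ 2 * f.coeff k) * Complex.I_sq

theorem coeff_eq_zero {f : PerDistr} (hf : f.HasZeroX1Average) {k : ℤ × ℤ}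
    (hk : k.1 = 0) : f.coeff k = 0 :=
  hf (TestFun.expo (-k)) fun x => by simp [TestFun.expo_apply, hk]

theorem heatSymbol_mul_coeff {f : PerDistr} (hf : f.HasZeroX1Average) (k : ℤ × ℤ) :
    heatSymbol k * f.coeff k = ((2 * Real.pi * |(k.1 : ℝ)| : ℝ) : ℂ) * f.opL.coeff k := by
  by_cases hk : k.1 = 0
  · simp [coeff_eq_zero hf hk, hk]
  · have abs_ne_zero : 2 * Real.pi * |(k.1 : ℝ)| ≠ 0 := by
      have : (k.1 : ℝ) ≠ 0 := by exact_mod_cast hk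
      have := Real.pi_pos
      positivity
    have heatSymbol_eq : heatSymbol k = 2 * Real.pi * |(k.1 : ℝ)|
        * ((2 * Real.pi * k.1) ^ 2 + (2 * Real.pi * |(k.1 : ℝ)|)⁻¹ * (2 * Real.pi * k.2) ^ 2) := by
      rw [mul_add, mul_inv_cancel_left₀ abs_ne_zero, heatSymbol]
      linear_combination (2 * Real.pi) ^ 3 * |(k.1 : ℝ)| * sq_abs (k.1 : ℝ)
    rw [coeff_opL, PerDistr.absInvSymbol, if_neg hk, heatSymbol_eq]
    push_cast; ring

theorem isSolution_of_coeff_opL {e l : ℕ} {f F : PerDistr} {g h : PerFun}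
    (hf : f.HasZeroX1Average) (hF : ∀ k, F.coeff k = hilbertPow l k.1 * f.coeff k)
    (hL : ∀ k ≠ 0, f.opL.coeff k = (2 * Real.pi * Complex.I * k.1) ^ e * g.toDistr.coeff k
      + 2 * Real.pi * Complex.I * k.2 * h.toDistr.coeff k) : IsSolution e l g h F.coeff := by
  intro k
  rcases eq_or_ne k 0 with rfl | hk
  · simp [hF, coeff_eq_zero hf]
  · rw [← hL k hk, hF, mul_left_comm, heatSymbol_mul_coeff hf, ← mul_assoc]

theorem exists_holderPos_le {α : ℝ} {e : ℕ} (he : 0 < α - 2 + e) (he' : α - 2 + e < 1)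
    (hα : α ∈ Set.Ioo (1 / 2 : ℝ) (3 / 2)) (hα1 : α ≠ 1) : ∃ C : ℝ≥0, C ≠ 0 ∧
    ∀ (l : ℕ) (F : PerDistr) (g h : PerFun), F.coeff 0 = 0 → IsSolution e l g h F.coeff →
      holderPos α F ≤ C * (holder (α - 2 + e) g + holder (α - 1 / 2) h) := by
  have h0 : 0 < α - 1 / 2 := by linarith [hα.1]
  have h1 : α - 1 / 2 < 1 := by linarith [hα.2]
  obtain ⟨D, hD, heatBound⟩ := exists_heatBound he.le he' h0.le h1
  obtain ⟨M, hM, exists_holder_le⟩ : ∃ M, 0 ≤ M ∧ ∀ (c : ℤ × ℤ → ℂ) (B : ℝ), 0 ≤ B →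
      PolyGrowth c → c 0 = 0 → HeatBound α B c →
      ∃ u : PerFun, (∀ k, u.toDistr.coeff k = c k) ∧ holder α u ≤ ENNReal.ofReal (M * B) := by
    rcases lt_or_gt_of_ne hα1 with h | h
    · exact exists_holder_le_of_lt_one (by linarith) h
    · exact exists_holder_le_of_one_lt h hα.2
  refine ⟨(M * D + 1).toNNReal, (Real.toNNReal_pos.2 (by positivity)).ne',
    fun l F g h hF hc => ?_⟩
  by_cases hg : holder (α - 2 + e) g = ⊤
  · rw [hg]; simp [add_pos_of_nonneg_of_pos (mul_nonneg hM hD) one_pos]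
  by_cases hh : holder (α - 1 / 2) h = ⊤
  · rw [hh]; simp [add_pos_of_nonneg_of_pos (mul_nonneg hM hD) one_pos]
  let G := (holder (α - 2 + e) g).toReal
  let H := (holder (α - 1 / 2) h).toReal
  have G_nonneg : 0 ≤ G := ENNReal.toReal_nonneg
  have H_nonneg : 0 ≤ H := ENNReal.toReal_nonneg
  obtain ⟨u, coeff_u, holder_le⟩ := exists_holder_le F.coeff (D * (G + H)) (by positivity)
    F.growth hF (heatBound l F.coeff g h G H G_nonneg H_nonneg
      (norm_sub_le_of_holder he he'.le hg) (norm_sub_le_of_holder h0 h1.le hh) hc)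
  calc holderPos α F ≤ ENNReal.ofReal (M * (D * (G + H))) :=
        (iInf₂_le u (PerDistr.ext_coeff coeff_u)).trans holder_le
    _ ≤ ENNReal.ofReal ((M * D + 1) * (G + H)) := ENNReal.ofReal_le_ofReal (by linarith)
    _ = ENNReal.ofReal (M * D + 1) * (holder (α - 2 + e) g + holder (α - 1 / 2) h) := by
        rw [ENNReal.ofReal_mul (by positivity), ENNReal.ofReal_add G_nonneg H_nonneg,
          ENNReal.ofReal_toReal hg, ENNReal.ofReal_toReal hh]

theorem exists_holderPos_add_holderPos_hilbert_le {α : ℝ} {e : ℕ} (he : 0 < α - 2 + e)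
    (he' : α - 2 + e < 1) (hα : α ∈ Set.Ioo (1 / 2 : ℝ) (3 / 2)) (hα1 : α ≠ 1) : ∃ C : ℝ≥0, C ≠ 0 ∧
    ∀ (f : PerDistr) (g h : PerFun), f.HasZeroX1Average →
      (∀ k ≠ 0, f.opL.coeff k = (2 * Real.pi * Complex.I * k.1) ^ e * g.toDistr.coeff k
        + 2 * Real.pi * Complex.I * k.2 * h.toDistr.coeff k) →
      holderPos α f + holderPos α f.hilbert
        ≤ C * (holder (α - 2 + e) g + holder (α - 1 / 2) h) := by
  obtain ⟨C, hC, holderPos_le⟩ := exists_holderPos_le he he' hα hα1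
  refine ⟨2 * C, mul_ne_zero two_ne_zero hC, fun f g h hf hL => ?_⟩
  have bound {l : ℕ} {F : PerDistr} (hF : ∀ k, F.coeff k = hilbertPow l k.1 * f.coeff k) :=
    holderPos_le l F g h (by rw [hF, coeff_eq_zero hf rfl, mul_zero])
      (isSolution_of_coeff_opL hf hF hL)
  have bound_self := bound (l := 0) (F := f) fun k => by rw [hilbertPow, pow_zero, one_mul]
  have bound_hilbert := bound (l := 1) (F := f.hilbert) fun k => by
    rw [hilbertPow, pow_one]; exact PerDistr.coeff_multiplier _ _ _ _
  refine (add_le_add bound_self bound_hilbert).trans_eq ?_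
  push_cast; ring

end AnisoTorus

end

theorem lemma2 (α : ℝ) (hα : α ∈ Set.Ioo (1 / 2 : ℝ) (3 / 2)) (hα1 : α ≠ 1) :
    ∃ C : NNReal, ∀ f : AnisoTorus.PerDistr, f.HasZeroX1Average →
      AnisoTorus.holderPos α f + AnisoTorus.holderPos α f.hilbert
        ≤ (C : ENNReal) * AnisoTorus.holderNeg (α - 2) f.opL := by
  open AnisoTorus in
  have exponent : α - 2 + 3 / 2 = α - 1 / 2 := by ring
  rcases lt_or_gt_of_ne hα1 with h1 | h1
  · obtain ⟨C, hC, schauder⟩ := exists_holderPos_add_holderPos_hilbert_le (e := 2)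
      (by push_cast; linarith [hα.1]) (by push_cast; linarith) hα hα1
    push_cast at schauder
    refine ⟨C, fun f hf => ?_⟩
    rw [holderNeg, if_neg (by linarith), exponent]
    simp only [ENNReal.mul_iInf_of_ne (ENNReal.coe_ne_zero.2 hC) ENNReal.coe_ne_top, le_iInf_iff]
    intro c g h decomposition
    refine (schauder f g h hf fun k hk => ?_).trans
      (by rw [add_assoc]; exact mul_le_mul_right le_add_self _)
    rw [decomposition, coeff_add, coeff_add, coeff_d1, coeff_d1, coeff_d2, coeff_const, if_neg hk]
    ring
  · obtain ⟨C, hC, schauder⟩ := exists_holderPos_add_holderPos_hilbert_le (e := 1)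
      (by push_cast; linarith) (by push_cast; linarith [hα.2]) hα hα1
    push_cast at schauder
    refine ⟨C, fun f hf => ?_⟩
    rw [holderNeg, if_pos (by linarith), exponent]
    simp only [ENNReal.mul_iInf_of_ne (ENNReal.coe_ne_zero.2 hC) ENNReal.coe_ne_top, le_iInf_iff]
    intro c g h decomposition
    refine (schauder f g h hf fun k hk => ?_).trans
      (by rw [add_assoc]; exact mul_le_mul_right le_add_self _)
    rw [decomposition, coeff_add, coeff_add, coeff_d1, coeff_d2, coeff_const, if_neg hk]
    ring
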